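/- All manifolds are real, smooth ($C^\infty$), finite-dimensional, without boundary, Hausdorff and second countable. A Lie group bundle over a manifold $M$ with typical fiber a Lie group $G$ is a smooth fiber bundle $\pi:\bar G\to M$ with typical fiber $G$, equipped with smooth maps over $M$, the product $\bar G\times_M\bar G\to\bar G$, $(h,g)\mapsto hg$, and the inversion $\bar G\to\bar G$, $g\mapsto g^{-1}$, and with a smooth global section $1$ of $\bar G$, the unit, which make every fiber $\bar G_m=\pi^{-1}(m)$ a Lie group in such a way that this structure is locally constant along $M$: $M$ is covered by open sets $U$ with smooth local trivializations $\Phi:\pi^{-1}(U)\to U\times G$ for which every map $\Phi_m:\bar G_m\to G$, $m\in U$, is an isomorphism of Lie groups. For $r\ge 1$ let $J^r\bar G$ be the set of $r$-jets $j^r_m\sigma$ of smooth local sections $\sigma$ of $\bar G$ defined near $m$, where $m\in M$ and $j^r_m\sigma=j^r_m\tau$ means that $\sigma(m)=\tau(m)$ and that, in local charts, $\sigma$ and $\tau$ have the same derivatives at $m$ up to order $r$. **Theorem.** Let $\pi:\bar G\to M$ be a Lie group bundle over $M$ with typical fiber a Lie group $G$, and let $r\ge 1$. Then $J^r\bar G$,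 with its standard smooth structure (the one for which, for every pair of a smooth chart $\varphi$ of $M$ and an adapted smooth chart $\psi=(\varphi\circ\pi,u)$ of $\bar G$, with $u$ taking values in the model space of $G$, the coordinates $j^r_m\sigma\mapsto\bigl(\varphi(m),\,(D^k(u\circ\sigma\circ\varphi^{-1})(\varphi(m)))_{0\le k\le r}\bigr)$ on $\{j^r_m\sigma:\sigma(m)\in\operatorname{dom}\psi\}$ are a smooth chart), is a manifold. Together with the source projection $J^r\bar G\to M$, $j^r_m\sigma\mapsto m$, it is again a Lie group bundle over $M$, with the operations obtained by applying those of $\bar G$ pointwise to local sections and taking $r$-jets: for all $m\in M$ and all smooth local sections $\sigma,\tau$ of $\bar G$ defined near $m$, $$(j^r_m\sigma)(j^r_m\tau)=j^r_m(\sigma\tau),\qquad 1_m=j^r_m 1,\qquad (j^r_m\sigma)^{-1}=j^r_m(\sigma^{-1}).$$ In particular, these operations are well defined. -/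

import Mathlib

open scoped Manifold ContDiff Topology

universe uE uG uM uP uT

noncomputable section

/-! ### Manifolds and Lie group bundles -/

/-- `X`, with its atlas of charts in the normed space `E`, is a smooth manifold: finite-dimensional,
without boundary, of class `C^∞`, Hausdorff and second countable. -/
structure IsSmoothManifold (E X : Type*) [NormedAddCommGroup E] [NormedSpace ℝ E]
    [TopologicalSpace X] [ChartedSpace E X] : Prop where
  finiteDimensional : FiniteDimensional ℝ E
  isManifold : IsManifold 𝓘(ℝ, E) ∞ X
  t2Space : T2Space X
  secondCountableTopology : SecondCountableTopology X

/-- `π : P → M`, with product `mul`, unit section `one` and inversion `inv`, is a Lie group bundle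
over `M` with typical fiber the Lie group `G`. The manifolds `M`, `P`, `G` have their charts in
`EM`, `EP`, `F`. Only the values of `mul` on the fiber product `{(p, q) | π p = π q}` matter. -/
structure IsLieGroupBundle {M P : Type*} (EM EP F G : Type*)
    [NormedAddCommGroup EM] [NormedSpace ℝ EM] [TopologicalSpace M] [ChartedSpace EM M]
    [NormedAddCommGroup EP] [NormedSpace ℝ EP] [TopologicalSpace P] [ChartedSpace EP P]
    [NormedAddCommGroup F] [NormedSpace ℝ F] [TopologicalSpace G] [ChartedSpace F G] [Group G]
    (π : P → M) (mul : P → P → P) (one : M → P) (inv : P → P) : Prop where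
  base : IsSmoothManifold EM M
  total : IsSmoothManifold EP P
  fiber : IsSmoothManifold F G
  lieGroup : LieGroup 𝓘(ℝ, F) ∞ G
  contMDiff_proj : ContMDiff 𝓘(ℝ, EP) 𝓘(ℝ, EM) ∞ π
  -- the product is a smooth map over `M` on the fiber product (a submanifold of `P × P`)
  proj_mul : ∀ p q, π p = π q → π (mul p q) = π p
  contMDiffOn_mul : ContMDiffOn (𝓘(ℝ, EP).prod 𝓘(ℝ, EP)) 𝓘(ℝ, EP) ∞
    (fun x : P × P => mul x.1 x.2) {x : P × P | π x.1 = π x.2}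
  -- the unit is a smooth global section
  proj_one : ∀ m, π (one m) = m
  contMDiff_one : ContMDiff 𝓘(ℝ, EM) 𝓘(ℝ, EP) ∞ one
  -- the inversion is a smooth map over `M`
  proj_inv : ∀ p, π (inv p) = π p
  contMDiff_inv : ContMDiff 𝓘(ℝ, EP) 𝓘(ℝ, EP) ∞ inv
  -- each fiber is a group
  mul_assoc : ∀ p q s, π p = π q → π q = π s → mul (mul p q) s = mul p (mul q s)
  one_mul : ∀ p, mul (one (π p)) p = p
  mul_one : ∀ p, mul p (one (π p)) = p
  inv_mul : ∀ p, mul (inv p) p = one (π p)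
  mul_inv : ∀ p, mul p (inv p) = one (π p)
  -- `M` is covered by smooth local trivializations with fiber `G` that are group isomorphisms
  -- on each fiber
  exists_trivialization : ∀ m, ∃ e : Bundle.Trivialization G π, m ∈ e.baseSet ∧
    ContMDiffOn 𝓘(ℝ, EP) (𝓘(ℝ, EM).prod 𝓘(ℝ, F)) ∞ e e.source ∧
    ContMDiffOn (𝓘(ℝ, EM).prod 𝓘(ℝ, F)) 𝓘(ℝ, EP) ∞ e.toOpenPartialHomeomorph.symm e.target ∧
    (∀ p q, π p ∈ e.baseSet → π p = π q → (e (mul p q)).2 = (e p).2 * (e q).2) ∧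
    (∀ x ∈ e.baseSet, (e (one x)).2 = 1) ∧
    (∀ p, π p ∈ e.baseSet → (e (inv p)).2 = (e p).2⁻¹)

/-! ### Jets of local sections -/

section Jets

variable {M P : Type*} (EM EP F : Type*)
  [NormedAddCommGroup EM] [NormedSpace ℝ EM] [TopologicalSpace M] [ChartedSpace EM M]
  [NormedAddCommGroup EP] [NormedSpace ℝ EP] [TopologicalSpace P] [ChartedSpace EP P]
  [NormedAddCommGroup F] [NormedSpace ℝ F]

/-- A smooth local section of `π` defined around `m`. It is represented by a function on all of
`M`, whose values away from some open neighbourhood of `m` are irrelevant. -/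
structure LocalSection (π : P → M) (m : M) where
  toFun : M → P
  exists_nhd : ∃ U : Set M, IsOpen U ∧ m ∈ U ∧
    ContMDiffOn 𝓘(ℝ, EM) 𝓘(ℝ, EP) ∞ toFun U ∧ ∀ x ∈ U, π (toFun x) = x

/-- Two local sections around `m` have the same `r`-jet at `m`: they have the same value at `m`,
and in charts around `m` and around this value they have the same derivatives up to order `r`. -/
def jetSetoid (r : ℕ) (π : P → M) (m : M) : Setoid (LocalSection EM EP π m) where
  r σ τ := σ.toFun m = τ.toFun m ∧ ∀ k ≤ r,
    iteratedFDeriv ℝ k (chartAt EP (σ.toFun m) ∘ σ.toFun ∘ (chartAt EM m).symm) (chartAt EM m m) =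
    iteratedFDeriv ℝ k (chartAt EP (τ.toFun m) ∘ τ.toFun ∘ (chartAt EM m).symm) (chartAt EM m m)
  iseqv :=
    ⟨fun _ => ⟨rfl, fun _ _ => rfl⟩, fun h => ⟨h.1.symm, fun k hk => (h.2 k hk).symm⟩,
      fun h h' => ⟨h.1.trans h'.1, fun k hk => (h.2 k hk).trans (h'.2 k hk)⟩⟩

/-- The set `J^r P` of `r`-jets of local sections of `π : P → M`. -/
structure Jet (r : ℕ) (π : P → M) where
  /-- the source projection `J^r P → M` -/
  source : M
  /-- the class of local sections around the source point -/
  cls : Quotient (jetSetoid EM EP r π source)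

variable {EM EP} in
/-- The `r`-jet `j^r_m σ` at `m` of a local section `σ` around `m`. -/
def jetAt (r : ℕ) {π : P → M} {m : M} (σ : LocalSection EM EP π m) : Jet EM EP r π :=
  ⟨m, Quotient.mk _ σ⟩

/-- The space of symmetric `k`-linear maps from `EM` to `F`. -/
def SymmMultilinear (k : ℕ) : Submodule ℝ (ContinuousMultilinearMap ℝ (fun _ : Fin k => EM) F) where
  carrier := {f | ∀ (s : Equiv.Perm (Fin k)) (v : Fin k → EM), f (v ∘ s) = f v}
  add_mem' hf hg s v := by
    rw [add_apply, add_apply, hf s v, hg s v]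
  zero_mem' _ _ := rfl
  smul_mem' c f hf s v := by
    rw [smul_apply, smul_apply, hf s v]

/-- The coordinates of an `r`-jet along the fiber: the derivatives of orders `0, …, r` at a point
of an `F`-valued function on `EM`. -/
def JetFiberModel (r : ℕ) : Type _ := (k : Fin (r + 1)) → SymmMultilinear EM F (k : ℕ)

instance (r : ℕ) : NormedAddCommGroup (JetFiberModel EM F r) :=
  inferInstanceAs (NormedAddCommGroup ((k : Fin (r + 1)) → SymmMultilinear EM F (k : ℕ)))

instance (r : ℕ) : NormedSpace ℝ (JetFiberModel EM F r) :=
  inferInstanceAs (NormedSpace ℝ ((k : Fin (r + 1)) → SymmMultilinear EM F (k : ℕ)))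

/-- `ψ` is a smooth chart of `P` adapted to `π : P → M` over the smooth chart `φ` of `M`:
it has the form `p ↦ (φ (π p), u p)`. -/
structure IsAdaptedChart (π : P → M) (φ : OpenPartialHomeomorph M EM)
    (ψ : OpenPartialHomeomorph P (EM × F)) : Prop where
  base_mem : φ ∈ IsManifold.maximalAtlas 𝓘(ℝ, EM) ∞ M
  contMDiffOn : ContMDiffOn 𝓘(ℝ, EP) 𝓘(ℝ, EM × F) ∞ ψ ψ.source
  contMDiffOn_symm : ContMDiffOn 𝓘(ℝ, EM × F) 𝓘(ℝ, EP) ∞ ψ.symm ψ.target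
  proj_mem : ∀ p ∈ ψ.source, π p ∈ φ.source
  fst_eq : ∀ p ∈ ψ.source, (ψ p).1 = φ (π p)

/-- The topology and the atlas on `J^r P` define the standard smooth structure of the jet bundle:
for every adapted chart `ψ = (φ ∘ π, u)` of `P`, the induced jet coordinates
`j^r_m σ ↦ (φ m, (D^k (u ∘ σ ∘ φ⁻¹) (φ m))_{k ≤ r})` on the set of jets with
`σ m ∈ ψ.source` are a smooth chart. As these charts cover the jet bundle of a fiber bundle with
fibers of dimension `dim F`, this determines the topology and the smooth structure. -/
def IsJetSmoothStructure (r : ℕ) (π : P → M) [TopologicalSpace (Jet EM EP r π)]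
    [ChartedSpace (EM × JetFiberModel EM F r) (Jet EM EP r π)] : Prop :=
  ∀ (φ : OpenPartialHomeomorph M EM) (ψ : OpenPartialHomeomorph P (EM × F)),
    IsAdaptedChart EM EP F π φ ψ →
    ∃ e ∈ IsManifold.maximalAtlas 𝓘(ℝ, EM × JetFiberModel EM F r) ∞ (Jet EM EP r π),
      (∀ (m : M) (σ : LocalSection EM EP π m),
        jetAt r σ ∈ e.source ↔ σ.toFun m ∈ ψ.source) ∧
      ∀ (m : M) (σ : LocalSection EM EP π m), σ.toFun m ∈ ψ.source →
        (e (jetAt r σ)).1 = φ m ∧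
        ∀ k : Fin (r + 1),
          ((e (jetAt r σ)).2 k : ContinuousMultilinearMap ℝ (fun _ : Fin (k : ℕ) => EM) F) =
            iteratedFDeriv ℝ k (fun y => (ψ (σ.toFun (φ.symm y))).2) (φ m)

end Jets

/-! ### Pointwise operations on local sections of a Lie group bundle -/

namespace IsLieGroupBundle

variable {M P EM EP F G : Type*}
  [NormedAddCommGroup EM] [NormedSpace ℝ EM] [TopologicalSpace M] [ChartedSpace EM M]
  [NormedAddCommGroup EP] [NormedSpace ℝ EP] [TopologicalSpace P] [ChartedSpace EP P]
  [NormedAddCommGroup F] [NormedSpace ℝ F] [TopologicalSpace G] [ChartedSpace F G] [Group G]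
  {π : P → M} {mul : P → P → P} {one : M → P} {inv : P → P}

/-- The pointwise product of two local sections around `m`. -/
def mulSection (h : IsLieGroupBundle EM EP F G π mul one inv) {m : M}
    (σ τ : LocalSection EM EP π m) : LocalSection EM EP π m where
  toFun x := mul (σ.toFun x) (τ.toFun x)
  exists_nhd := by
    obtain ⟨U, hU, hmU, hσ, hσ'⟩ := σ.exists_nhd
    obtain ⟨V, hV, hmV, hτ, hτ'⟩ := τ.exists_nhd
    have key : ∀ x ∈ U ∩ V, π (σ.toFun x) = π (τ.toFun x) := fun x hx => by
      rw [hσ' x hx.1, hτ' x hx.2]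
    refine ⟨U ∩ V, hU.inter hV, ⟨hmU, hmV⟩, ?_, fun x hx => ?_⟩
    · exact h.contMDiffOn_mul.comp
        ((hσ.mono Set.inter_subset_left).prodMk (hτ.mono Set.inter_subset_right)) key
    · rw [h.proj_mul _ _ (key x hx), hσ' x hx.1]

/-- The unit section, as a local section around `m`. -/
def oneSection (h : IsLieGroupBundle EM EP F G π mul one inv) (m : M) :
    LocalSection EM EP π m where
  toFun := one
  exists_nhd := ⟨Set.univ, isOpen_univ, Set.mem_univ m, h.contMDiff_one.contMDiffOn,
    fun x _ => h.proj_one x⟩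

/-- The pointwise inverse of a local section around `m`. -/
def invSection (h : IsLieGroupBundle EM EP F G π mul one inv) {m : M}
    (σ : LocalSection EM EP π m) : LocalSection EM EP π m where
  toFun x := inv (σ.toFun x)
  exists_nhd := by
    obtain ⟨U, hU, hmU, hσ, hσ'⟩ := σ.exists_nhd
    refine ⟨U, hU, hmU, h.contMDiff_inv.comp_contMDiffOn hσ, fun x hx => ?_⟩
    rw [h.proj_inv, hσ' x hx]

end IsLieGroupBundle

end

/-! In a chart `φ` of `M` and a fibrewise multiplicative trivialization `e`, a jet of a section `σ`
at `m` amounts to two independent data: the point `m`, and the `r`-jet at the origin of the map `y ↦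
(e (σ (φ⁻¹ (φ m + y)))).2` from `EM` to `G`. So the jet bundle is locally the product of `M` with
`JetGroup EM F G r`, the group of `r`-jets at `0` of maps `EM → G`. Because `e` is multiplicative on
all fibers near `m`, and not only over `m`, this identification turns products of sections into
products in `JetGroup`. It remains to see that `JetGroup` is a Lie group, that the jets form a
manifold in their jet coordinates, and that the identification is a diffeomorphism.

Both manifolds come from `IsCoordinateSystem.exists_chartedSpace`, with preimages of open sets under
the map "jet to value" as chart domains. The coordinates of a jet are its derivatives, which are
symmetric (`iteratedFDeriv_mem_symmMultilinear`); conversely, any tuple of symmetric forms consists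
of the derivatives of its Taylor polynomial (`JetFiberModel.iteratedFDeriv_taylor`), so the
coordinates are bijective onto an open set.

Operations on jets are well defined by the Faà di Bruno formula (`SameJet.comp`). For smoothness
they are computed on Taylor polynomials, which depend smoothly on the coordinates; the derivatives
of a smoothly parametrized map depend smoothly on the parameter (`JetFiberModel.contDiffAt_of`). In
matching charts the trivialization of the jet bundle is the identity (`coord_fiberJet`), hence
smooth both ways. The group axioms hold for local sections pointwise and pass to jets. -/

noncomputable section

/-! ### Symmetry of higher derivatives -/

open Filter in
/-- The `k`-th derivative of a `C^k` function is symmetric. -/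
theorem iteratedFDeriv_mem_symmMultilinear {E F : Type*} [NormedAddCommGroup E] [NormedSpace ℝ E]
    [NormedAddCommGroup F] [NormedSpace ℝ F] {u : E → F} (k : ℕ) {x : E}
    (hx : ContDiffAt ℝ k u x) : iteratedFDeriv ℝ k u x ∈ SymmMultilinear E F k := by
  induction k generalizing x with
  | zero => intro s v; congr 1; exact Subsingleton.elim _ _
  | succ n ih =>
    have hd : DifferentiableAt ℝ (iteratedFDeriv ℝ n u) x :=
      (hx.iteratedFDeriv_right (m := 1) (by rw [add_comm]; norm_cast)).differentiableAt (by simp)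
    -- Symmetry in the last `n` arguments: the induction hypothesis holds at all points near `x`, so
    -- it can be differentiated once more.
    have htail : ∀ (s : Equiv.Perm (Fin n)) (a : E) (v : Fin n → E),
        iteratedFDeriv ℝ (n + 1) u x (Fin.cons a (v ∘ s)) =
          iteratedFDeriv ℝ (n + 1) u x (Fin.cons a v) := by
      intro s a v
      rw [hd.iteratedFDeriv_succ_apply_left', hd.iteratedFDeriv_succ_apply_left']
      simp only [Fin.tail_cons, Fin.cons_zero]
      have : (fun y => iteratedFDeriv ℝ n u y (v ∘ s)) =ᶠ[𝓝 x]
          fun y => iteratedFDeriv ℝ n u y v := by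
        filter_upwards [hx.eventually (by simp)] with y hy
        exact ih (hy.of_le (by exact_mod_cast Nat.le_succ n)) s v
      rw [this.fderiv_eq]
    -- The permutations that leave the derivative invariant form a submonoid, and adjacent
    -- transpositions generate all permutations as a monoid; only these need checking.
    let N : Submonoid (Equiv.Perm (Fin (n + 1))) :=
      { carrier := {s | ∀ v, iteratedFDeriv ℝ (n + 1) u x (v ∘ s) = iteratedFDeriv ℝ (n + 1) u x v}
        mul_mem' := fun {a b} ha hb v => by
          rw [Equiv.Perm.coe_mul, ← Function.comp_assoc, hb, ha]
        one_mem' := fun v => rfl }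
    suffices hN : N = ⊤ from fun s => (hN ▸ Submonoid.mem_top s : s ∈ N)
    rw [eq_top_iff, ← Equiv.Perm.mclosure_swap_castSucc_succ, Submonoid.closure_le]
    rintro _ ⟨i, rfl⟩ v
    cases n with
    | zero => exact i.elim0
    | succ n =>
    refine Fin.cases ?_ (fun j => ?_) i
    -- Exchanging the first two arguments is the symmetry of the second derivative of `y ↦ D^n u(y)
    -- v`.
    · obtain ⟨a, v, rfl⟩ : ∃ a w, v = Fin.cons a w := ⟨v 0, Fin.tail v, (Fin.cons_self_tail v).symm⟩
      obtain ⟨b, v, rfl⟩ : ∃ a w, v = Fin.cons a w := ⟨v 0, Fin.tail v, (Fin.cons_self_tail v).symm⟩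
      have hsw : (Fin.cons a (Fin.cons b v : Fin (n + 1) → E) : Fin (n + 2) → E) ∘
          Equiv.swap (Fin.castSucc 0) (Fin.succ 0) = Fin.cons b (Fin.cons a v : Fin (n + 1) → E) := by
        funext l
        refine Fin.cases ?_ (fun l => ?_) l
        · simp
        · refine Fin.cases ?_ (fun l => ?_) l
          · simp
          · rw [Function.comp_apply, Equiv.swap_apply_of_ne_of_ne]
            · simp
            · simp [Fin.ext_iff]
            · simp [Fin.ext_iff]
      rw [hsw]
      have key : ∀ a b : E, iteratedFDeriv ℝ (n + 2) u x
          (Fin.cons a (Fin.cons b v : Fin (n + 1) → E)) =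
          fderiv ℝ (fderiv ℝ (fun y => iteratedFDeriv ℝ n u y v)) x a b := by
        intro a b
        rw [hd.iteratedFDeriv_succ_apply_left']
        simp only [Fin.tail_cons, Fin.cons_zero]
        have h2 : (fun y => iteratedFDeriv ℝ (n + 1) u y (Fin.cons b v)) =ᶠ[𝓝 x]
            fun y => fderiv ℝ (fun y => iteratedFDeriv ℝ n u y v) y b := by
          filter_upwards [hx.eventually (by simp)] with y hy
          rw [DifferentiableAt.iteratedFDeriv_succ_apply_left']
          · simp
          · exact (hy.iteratedFDeriv_right (m := 1)
              (by norm_cast; lia)).differentiableAt (by simp)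
        rw [h2.fderiv_eq]
        have h3 : DifferentiableAt ℝ (fderiv ℝ (fun y => iteratedFDeriv ℝ n u y v)) x := by
          refine (ContDiffAt.fderiv_right (m := 1) (n := 2) ?_ (by norm_num)).differentiableAt
            (by simp)
          exact ((ContinuousMultilinearMap.apply ℝ (fun _ : Fin n => E) F v).contDiff.contDiffAt).comp
            x (hx.iteratedFDeriv_right (m := 2) (by norm_cast; lia))
        rw [fderiv_clm_apply h3 (differentiableAt_const b)]
        simp
      rw [key, key]
      refine ContDiffAt.isSymmSndFDerivAt (n := 2) ?_ (by simp) b a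
      exact ((ContinuousMultilinearMap.apply ℝ (fun _ : Fin n => E) F v).contDiff.contDiffAt).comp
        x (hx.iteratedFDeriv_right (m := 2) (by norm_cast; lia))
    -- Every other adjacent transposition fixes the first argument, so `htail` applies.
    · obtain ⟨a, v, rfl⟩ : ∃ a w, v = Fin.cons a w := ⟨v 0, Fin.tail v, (Fin.cons_self_tail v).symm⟩
      rw [← htail (Equiv.swap j.castSucc j.succ) a v]
      congr 1
      funext l
      refine Fin.cases ?_ (fun l => ?_) l
      · rw [Function.comp_apply, Equiv.swap_apply_of_ne_of_ne] <;> simp [Fin.ext_iff]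
      · have := (Fin.succ_injective (n + 1)).swap_apply j.castSucc j.succ l
        simp only [Function.comp_apply, Fin.cons_succ]
        rw [← Fin.succ_castSucc, this, Fin.cons_succ]

/-! ### Jets of maps between normed spaces -/

section SameJet

variable {E E' F F' : Type*} [NormedAddCommGroup E] [NormedSpace ℝ E]
  [NormedAddCommGroup E'] [NormedSpace ℝ E']
  [NormedAddCommGroup F] [NormedSpace ℝ F] [NormedAddCommGroup F'] [NormedSpace ℝ F']

/-- Two maps have the same derivatives up to order `r` at a point. -/
def SameJet (r : ℕ) (f g : E → F) (x : E) : Prop :=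
  ∀ k ≤ r, iteratedFDeriv ℝ k f x = iteratedFDeriv ℝ k g x

variable {r : ℕ} {f g h : E → F} {x : E}

theorem SameJet.rfl : SameJet r f f x := fun _ _ => Eq.refl _

theorem SameJet.symm (H : SameJet r f g x) : SameJet r g f x := fun k hk => (H k hk).symm

theorem SameJet.trans (H : SameJet r f g x) (H' : SameJet r g h x) : SameJet r f h x :=
  fun k hk => (H k hk).trans (H' k hk)

theorem SameJet.of_eventuallyEq (H : f =ᶠ[𝓝 x] g) : SameJet r f g x :=
  fun k _ => (H.iteratedFDeriv ℝ k).self_of_nhds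

theorem SameJet.congr {f' g' : E → F} (H : SameJet r f g x) (hf : f' =ᶠ[𝓝 x] f)
    (hg : g' =ᶠ[𝓝 x] g) : SameJet r f' g' x :=
  (of_eventuallyEq hf).trans (H.trans (of_eventuallyEq hg.symm))

theorem SameJet.apply_eq (H : SameJet r f g x) : f x = g x := by
  have := congrArg (fun m => m 0) (H 0 (Nat.zero_le _))
  simpa using this

theorem SameJet.prodMk {f' g' : E → F'} (H : SameJet r f g x) (H' : SameJet r f' g' x)
    (hf : ContDiffAt ℝ ∞ f x) (hg : ContDiffAt ℝ ∞ g x)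
    (hf' : ContDiffAt ℝ ∞ f' x) (hg' : ContDiffAt ℝ ∞ g' x) :
    SameJet r (fun y => (f y, f' y)) (fun y => (g y, g' y)) x := by
  intro k hk
  have hk' : (k : WithTop ℕ∞) ≤ ∞ := by exact_mod_cast le_top
  rw [iteratedFDeriv_prodMk hf hf' hk', iteratedFDeriv_prodMk hg hg' hk', H k hk, H' k hk]

/-- Faà di Bruno: each term of the `k`-th derivative of a composition involves one outer derivative,
of order the number of parts of a partition of `k`, and inner derivatives of order the sizes of the
parts, all at most `k`. This is applied to precomposition with `B` and then to postcomposition with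
`A`; equality of values ensures that `A` is differentiated at the same point. -/
theorem SameJet.comp {A : F → F'} {B : E' → E} {y : E'} (H : SameJet r f g (B y))
    (hf : ContDiffAt ℝ ∞ f (B y)) (hg : ContDiffAt ℝ ∞ g (B y))
    (hA : ContDiffAt ℝ ∞ A (f (B y))) (hB : ContDiffAt ℝ ∞ B y) :
    SameJet r (fun z => A (f (B z))) (fun z => A (g (B z))) y := by
  have e := H.apply_eq
  have key : SameJet r (f ∘ B) (g ∘ B) y := by
    intro k hk
    have hk' : (k : WithTop ℕ∞) ≤ ∞ := by exact_mod_cast le_top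
    rw [iteratedFDeriv_comp hf hB hk', iteratedFDeriv_comp hg hB hk']
    refine Finset.sum_congr (Eq.refl _) fun c _ => ?_
    ext v
    simp only [FormalMultilinearSeries.compAlongOrderedFinpartition_apply, ftaylorSeries]
    rw [H _ (c.length_le.trans hk)]
  intro k hk
  have hk' : (k : WithTop ℕ∞) ≤ ∞ := by exact_mod_cast le_top
  have h1 := iteratedFDeriv_comp (f := f ∘ B) (x := y) hA (hf.comp y hB) hk'
  have h2 := iteratedFDeriv_comp (f := g ∘ B) (x := y) (g := A)
    (show ContDiffAt ℝ ∞ A (g (B y)) from e ▸ hA) (hg.comp y hB) hk'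
  change iteratedFDeriv ℝ k (A ∘ (f ∘ B)) y = iteratedFDeriv ℝ k (A ∘ (g ∘ B)) y
  rw [h1, h2]
  refine Finset.sum_congr (Eq.refl _) fun c _ => ?_
  ext v
  simp only [FormalMultilinearSeries.compAlongOrderedFinpartition_apply, ftaylorSeries,
    Function.comp_apply, e]
  congr 1
  funext m
  simp only [OrderedFinpartition.applyOrderedFinpartition_apply]
  rw [key _ ((c.partSize_le m).trans hk)]

theorem SameJet.comp_left {A : F → F'} (H : SameJet r f g x)
    (hf : ContDiffAt ℝ ∞ f x) (hg : ContDiffAt ℝ ∞ g x) (hA : ContDiffAt ℝ ∞ A (f x)) :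
    SameJet r (fun z => A (f z)) (fun z => A (g z)) x :=
  SameJet.comp (B := fun z => z) H hf hg hA contDiffAt_id

end SameJet

/-! ### Jet coordinates and Taylor polynomials -/

namespace JetFiberModel

variable {E F : Type*} [NormedAddCommGroup E] [NormedSpace ℝ E]
  [NormedAddCommGroup F] [NormedSpace ℝ F] {r : ℕ}

instance [FiniteDimensional ℝ E] [FiniteDimensional ℝ F] (k : ℕ) :
    FiniteDimensional ℝ (SymmMultilinear E F k) :=
  have : FiniteDimensional ℝ (ContinuousMultilinearMap ℝ (fun _ : Fin k => E) F) :=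
    FiniteDimensional.of_injective (ContinuousMultilinearMap.toMultilinearMapLinear (R' := ℝ))
      ContinuousMultilinearMap.toMultilinearMap_injective
  inferInstance

instance [FiniteDimensional ℝ E] [FiniteDimensional ℝ F] :
    FiniteDimensional ℝ (JetFiberModel E F r) :=
  inferInstanceAs (FiniteDimensional ℝ ((k : Fin (r + 1)) → SymmMultilinear E F (k : ℕ)))

/-- The derivative of order `k`, as a function of the jet. -/
def coeff (k : Fin (r + 1)) :
    JetFiberModel E F r →L[ℝ] ContinuousMultilinearMap ℝ (fun _ : Fin (k : ℕ) => E) F :=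
  (SymmMultilinear E F (k : ℕ)).subtypeL.comp
    (ContinuousLinearMap.proj (φ := fun k : Fin (r + 1) => SymmMultilinear E F (k : ℕ)) k :
      ((k : Fin (r + 1)) → SymmMultilinear E F (k : ℕ)) →L[ℝ] SymmMultilinear E F (k : ℕ))

theorem coeff_apply (k : Fin (r + 1)) (p : JetFiberModel E F r) :
    coeff k p = (p k : ContinuousMultilinearMap ℝ (fun _ : Fin (k : ℕ) => E) F) := Eq.refl _

@[ext]
theorem ext {p q : JetFiberModel E F r} (h : ∀ k, coeff k p = coeff k q) : p = q :=
  funext fun k => Subtype.ext (h k)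

/-- The value of a jet. -/
def value : JetFiberModel E F r →L[ℝ] F :=
  (ContinuousMultilinearMap.apply ℝ (fun _ : Fin ((0 : Fin (r + 1)) : ℕ) => E) F 0).comp (coeff 0)

/-- The polynomial with given derivatives at the origin. -/
def taylor (p : JetFiberModel E F r) (y : E) : F :=
  ∑ k : Fin (r + 1), ((k : ℕ).factorial : ℝ)⁻¹ • coeff k p fun _ => y

theorem contDiff_taylor [FiniteDimensional ℝ F] : ContDiff ℝ ω (fun z : JetFiberModel E F r × E => taylor z.1 z.2) := by
  have : CompleteSpace F := FiniteDimensional.complete ℝ F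
  refine ContDiff.sum fun k _ => contDiff_const.smul ?_
  refine contDiff_iff_contDiffAt.2 fun z => ?_
  have := (coeff (E := E) (F := F) k).analyticAt_uncurry_of_multilinear (x := (z.1, fun _ => z.2))
  refine (this.contDiffAt).comp z (f := fun z : JetFiberModel E F r × E => (z.1, fun _ => z.2)) ?_
  exact (contDiff_fst.prodMk (contDiff_pi.2 fun _ => contDiff_snd)).contDiffAt

theorem contDiff_taylor_right [FiniteDimensional ℝ F] (p : JetFiberModel E F r) : ContDiff ℝ ω (taylor p) :=
  contDiff_taylor.comp (contDiff_const.prodMk contDiff_id)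

theorem iteratedFDeriv_taylor [FiniteDimensional ℝ F] (p : JetFiberModel E F r) (k : Fin (r + 1)) :
    iteratedFDeriv ℝ (k : ℕ) (taylor p) 0 = coeff k p := by
  let P : FormalMultilinearSeries ℝ E F := fun n =>
    if h : n < r + 1 then ((n.factorial : ℝ)⁻¹ • coeff ⟨n, h⟩ p) else 0
  have hP : HasFiniteFPowerSeriesOnBall (taylor p) P 0 (r + 1) ⊤ := by
    refine HasFiniteFPowerSeriesOnBall.mk' (fun m hm => ?_) (by simp) (fun y _ => ?_)
    · exact dif_neg (not_lt.2 hm)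
    · rw [taylor, Finset.sum_range]
      refine Finset.sum_congr (Eq.refl _) fun i _ => ?_
      simp [P, dif_pos (Nat.lt_succ_iff.1 i.2)]
  have : CompleteSpace F := FiniteDimensional.complete ℝ F
  have hA : AnalyticOn ℝ (taylor p) Set.univ := fun y _ =>
    (hP.toHasFPowerSeriesOnBall.analyticAt_of_mem (by simp)).analyticWithinAt
  ext v
  rw [hP.toHasFPowerSeriesOnBall.iteratedFDeriv_eq_sum hA]
  -- The `k`-th derivative is the sum of the `k`-th coefficient over all permutations of the
  -- arguments. The coefficient is symmetric, so the `k!` terms agree and cancel the factor `1/k!`.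
  have : ∀ s : Equiv.Perm (Fin k), P k (fun i => v (s i)) = ((k : ℕ).factorial : ℝ)⁻¹ •
      coeff k p v := by
    intro s
    have h1 : P k = (((k : ℕ).factorial : ℝ)⁻¹ • coeff k p) := dif_pos k.2
    rw [h1, smul_apply]
    congr 1
    exact (p k).2 s v
  rw [Finset.sum_congr (Eq.refl _) fun s _ => this s, Finset.sum_const, Finset.card_univ,
    Fintype.card_perm, Fintype.card_fin, ← Nat.cast_smul_eq_nsmul ℝ, smul_smul,
    mul_inv_cancel₀ (by exact_mod_cast Nat.factorial_ne_zero _), one_smul]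

open Classical in
/-- A multilinear map as a symmetric multilinear map, if it is symmetric. -/
def toSymm {k : ℕ} (m : ContinuousMultilinearMap ℝ (fun _ : Fin k => E) F) :
    SymmMultilinear E F k :=
  -- The value `0` only serves to make `of` total; it does not occur at a point where the function
  -- is smooth.
  if h : m ∈ SymmMultilinear E F k then ⟨m, h⟩ else 0

theorem toSymm_of_mem {k : ℕ} {m : ContinuousMultilinearMap ℝ (fun _ : Fin k => E) F}
    (h : m ∈ SymmMultilinear E F k) : toSymm m = ⟨m, h⟩ := dif_pos h

/-- The derivatives of orders `0, …, r` of `u` at `x`, where `u` is smooth. -/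
def of (r : ℕ) (u : E → F) (x : E) : JetFiberModel E F r := fun k =>
  toSymm (iteratedFDeriv ℝ (k : ℕ) u x)

theorem coeff_of {u : E → F} {x : E} (hu : ContDiffAt ℝ ∞ u x) (k : Fin (r + 1)) :
    coeff k (of r u x) = iteratedFDeriv ℝ (k : ℕ) u x := by
  rw [coeff_apply, of, toSymm_of_mem (iteratedFDeriv_mem_symmMultilinear _
    (hu.of_le (by exact_mod_cast le_top)))]

theorem of_eq_of_iff {u v : E → F} {x y : E} (hu : ContDiffAt ℝ ∞ u x) (hv : ContDiffAt ℝ ∞ v y) :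
    of r u x = of r v y ↔ ∀ k ≤ r, iteratedFDeriv ℝ k u x = iteratedFDeriv ℝ k v y := by
  constructor
  · intro h k hk
    have := coeff_of (r := r) hu ⟨k, Nat.lt_succ_of_le hk⟩
    rw [h, coeff_of hv] at this
    exact this.symm
  · intro h
    ext1 k
    rw [coeff_of hu, coeff_of hv, h _ (Nat.le_of_lt_succ k.2)]

theorem of_eq_of_iff_sameJet {u v : E → F} {x : E} (hu : ContDiffAt ℝ ∞ u x)
    (hv : ContDiffAt ℝ ∞ v x) : of r u x = of r v x ↔ SameJet r u v x :=
  of_eq_of_iff hu hv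

theorem value_of {u : E → F} {x : E} (hu : ContDiffAt ℝ ∞ u x) : value (of r u x) = u x := by
  rw [value, ContinuousLinearMap.comp_apply, coeff_of hu]
  exact iteratedFDeriv_zero_apply (𝕜 := ℝ) (f := u) (x := x) 0

/-- This gives surjectivity of jet coordinates, with a representative that is smooth in the
coordinates and the base point jointly. -/
theorem of_taylor_sub [FiniteDimensional ℝ F] (p : JetFiberModel E F r) (x : E) :
    of r (fun y => taylor p (y - x)) x = p := by
  ext1 k
  rw [coeff_of, iteratedFDeriv_comp_sub, sub_self, iteratedFDeriv_taylor]
  exact (((contDiff_taylor_right p).comp (contDiff_id.sub contDiff_const)).of_le le_top).contDiffAt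

theorem of_taylor [FiniteDimensional ℝ F] (p : JetFiberModel E F r) : of r (taylor p) 0 = p := by
  simpa using of_taylor_sub p 0

theorem taylor_zero [FiniteDimensional ℝ F] (p : JetFiberModel E F r) : taylor p 0 = value p := by
  rw [← value_of (r := r) (u := taylor p) (x := 0), of_taylor]
  exact ((contDiff_taylor_right p).of_le le_top).contDiffAt

theorem of_congr {u v : E → F} {x : E} (h : u =ᶠ[𝓝 x] v) : of r u x = of r v x := by
  funext k
  exact congrArg toSymm (h.iteratedFDeriv ℝ (k : ℕ)).self_of_nhds

theorem of_comp_add_left (u : E → F) (a x : E) :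
    of r (fun y => u (a + y)) x = of r u (a + x) := by
  funext k
  exact congrArg toSymm (iteratedFDeriv_comp_add_left _ _ _)

/-- Partial derivatives of higher order. -/
theorem _root_.ContDiffAt.iteratedFDeriv_partial {N : Type*}
    [NormedAddCommGroup N] [NormedSpace ℝ N] {k : ℕ} {H : N × E → F} {n : N} {y : E}
    (hH : ContDiffAt ℝ k H (n, y)) :
    iteratedFDeriv ℝ k (fun y => H (n, y)) y =
      (iteratedFDeriv ℝ k H (n, y)).compContinuousLinearMap
        fun _ => ContinuousLinearMap.inr ℝ N E := by
  let ι : E →L[ℝ] N × E := ContinuousLinearMap.inr ℝ N E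
  have hsum : ∀ y : E, (n, (0 : E)) + ι y = (n, y) := fun y => by simp [ι]
  -- The translation replaces the affine inclusion `y ↦ (n, y)` by the linear map `ι`.
  let H' : N × E → F := fun w => H ((n, 0) + w)
  have hH' : ContDiffAt ℝ k H' (ι y) := by
    refine ContDiffAt.comp (ι y) ?_ (contDiffAt_const.add contDiffAt_id)
    simpa only [id, hsum] using hH
  have h1 : (fun y => H (n, y)) = H' ∘ ι := by
    funext y
    simp only [H', Function.comp_apply, hsum]
  -- The chain rule for `ι` is applied to derivatives within an open set on which `H'` is `C^k`; on
  -- open sets these are the full derivatives.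
  obtain ⟨u, hu, hyu, hHu⟩ := hH'.contDiffWithinAt.contDiffOn' le_rfl (by simp)
  rw [Set.insert_eq_of_mem (Set.mem_univ _), Set.univ_inter] at hHu
  have hu' : IsOpen (ι ⁻¹' u) := hu.preimage ι.continuous
  rw [h1, ← iteratedFDerivWithin_of_isOpen k hu' (show y ∈ ι ⁻¹' u from hyu),
    ι.iteratedFDerivWithin_comp_right hHu hu.uniqueDiffOn hu'.uniqueDiffOn hyu le_rfl,
    iteratedFDerivWithin_of_isOpen k hu hyu, iteratedFDeriv_comp_add_left, hsum]

/-- Jet coordinates depend smoothly on parameters. -/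
theorem contDiffAt_of [FiniteDimensional ℝ E] [FiniteDimensional ℝ F] {N : Type*}
    [NormedAddCommGroup N] [NormedSpace ℝ N]
    {H : N × E → F} {c : N → E} {n₀ : N} (hH : ContDiffAt ℝ ∞ H (n₀, c n₀))
    (hc : ContDiffAt ℝ ∞ c n₀) :
    ContDiffAt ℝ ∞ (fun n => of r (fun y => H (n, y)) (c n)) n₀ := by
  suffices ∀ k : Fin (r + 1), ContDiffAt ℝ ∞
      (fun n => (of r (fun y => H (n, y)) (c n) k : SymmMultilinear E F (k : ℕ))) n₀ from
    (contDiffAt_pi (F' := fun k : Fin (r + 1) => SymmMultilinear E F (k : ℕ))).2 this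
  intro k
  -- A continuous projection `q` onto the symmetric maps. Smoothness holds in the space of all
  -- multilinear maps; `q` carries it to the subspace and fixes the derivatives, which are already
  -- symmetric.
  obtain ⟨q, hq⟩ := Submodule.ClosedComplemented.of_finiteDimensional (𝕜 := ℝ)
    (SymmMultilinear E F (k : ℕ))
  have hcont : Filter.Tendsto (fun n => (n, c n)) (𝓝 n₀) (𝓝 (n₀, c n₀)) :=
    (continuousAt_id.prodMk hc.continuousAt)
  let ι : E →L[ℝ] N × E := ContinuousLinearMap.inr ℝ N E
  have hD : ContDiffAt ℝ ∞ (fun n => q ((iteratedFDeriv ℝ (k : ℕ) H (n, c n)).compContinuousLinearMap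
      fun _ => ι)) n₀ := by
    refine (ContinuousLinearMap.contDiff (𝕜 := ℝ) (E := ContinuousMultilinearMap ℝ (fun _ : Fin (k : ℕ) => E) F)
      (F := SymmMultilinear E F (k : ℕ)) q).contDiffAt.comp n₀ ?_
    refine (ContinuousMultilinearMap.compContinuousLinearMapL (F := F)
      (fun _ : Fin (k : ℕ) => ι)).contDiff.contDiffAt.comp n₀ ?_
    exact (hH.iteratedFDeriv_right (m := ∞) (by norm_cast)).comp n₀ (contDiffAt_id.prodMk hc)
  refine hD.congr_of_eventuallyEq ?_
  have hev : ∀ᶠ z in 𝓝 (n₀, c n₀), ContDiffAt ℝ (k : ℕ) H z :=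
    (hH.of_le (by exact_mod_cast le_top)).eventually (by simp)
  filter_upwards [hcont.eventually hev] with n hn
  have hn' : ContDiffAt ℝ (k : ℕ) (fun y => H (n, y)) (c n) :=
    hn.comp (c n) (contDiffAt_const.prodMk contDiffAt_id)
  have hs := iteratedFDeriv_mem_symmMultilinear _ hn'
  change toSymm (iteratedFDeriv ℝ (k : ℕ) (fun y => H (n, y)) (c n)) = _
  rw [← hn.iteratedFDeriv_partial]
  rw [toSymm_of_mem hs]
  exact (hq ⟨_, hs⟩).symm

end JetFiberModel

/-! ### Manifolds from coordinate systems -/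

section Coordinates

variable {X Y H ι : Type*} [NormedAddCommGroup H] [NormedSpace ℝ H] [TopologicalSpace Y]

/-- Coordinates `c i` on the sets `f ⁻¹' V i`, with open images and smooth changes of coordinates.
The sets `V i` form a basis of open sets for the points in the range of `f`. -/
structure IsCoordinateSystem (f : X → Y) (V : ι → Set Y) (T : ι → Set H) (c : ι → X → H) :
    Prop where
  isOpen_base : ∀ i, IsOpen (V i)
  isOpen_target : ∀ i, IsOpen (T i)
  bijOn : ∀ i, Set.BijOn (c i) (f ⁻¹' V i) (T i)
  exists_subset : ∀ x W, IsOpen W → f x ∈ W → ∃ i, f x ∈ V i ∧ V i ⊆ W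
  transition : ∀ i j x, f x ∈ V i → f x ∈ V j → ∃ t : H → H, ContDiffAt ℝ ∞ t (c i x) ∧
    ∀ᶠ z in 𝓝 (c i x), ∀ x', f x' ∈ V i → c i x' = z → f x' ∈ V j ∧ c j x' = t z

namespace IsCoordinateSystem

variable {f : X → Y} {V : ι → Set Y} {T : ι → Set H} {c : ι → X → H} [Nonempty X]

/-- The coordinates as partial equivalences. -/
def chart (h : IsCoordinateSystem f V T c) (i : ι) : PartialEquiv X H :=
  (h.bijOn i).toPartialEquiv

variable (h : IsCoordinateSystem f V T c)
include h

/-- The local form of a coordinate change, from which openness of overlaps, continuity and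
smoothness are all read off. -/
theorem trans_aux (i j : ι) {z : H} (hz : z ∈ ((h.chart i).symm.trans (h.chart j)).source) :
    ∃ t : H → H, ContDiffAt ℝ ∞ t z ∧ ((h.chart i).symm.trans (h.chart j)) =ᶠ[𝓝 z] t ∧
      ((h.chart i).symm.trans (h.chart j)).source ∈ 𝓝 z := by
  rw [PartialEquiv.trans_source] at hz
  have hx : (h.chart i).symm z ∈ (h.chart i).source := (h.chart i).map_target hz.1
  have hzx : c i ((h.chart i).symm z) = z := (h.chart i).right_inv hz.1
  obtain ⟨t, ht, he⟩ := h.transition i j ((h.chart i).symm z) hx hz.2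
  rw [hzx] at ht he
  have key : ∀ᶠ w in 𝓝 z, w ∈ T i ∧ f ((h.chart i).symm w) ∈ V j ∧
      c j ((h.chart i).symm w) = t w := by
    filter_upwards [he, (h.isOpen_target i).mem_nhds hz.1] with w hw hw'
    exact ⟨hw', hw _ ((h.chart i).map_target hw') ((h.chart i).right_inv hw')⟩
  refine ⟨t, ht, ?_, ?_⟩
  · filter_upwards [key] with w hw using hw.2.2
  · filter_upwards [key] with w hw
    exact ⟨hw.1, hw.2.1⟩

/-- The atlas of all the coordinates. -/
def core : ChartedSpaceCore H X where
  atlas := Set.range h.chart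
  chartAt x := h.chart (h.exists_subset x Set.univ isOpen_univ (Set.mem_univ _)).choose
  mem_chart_source x := (h.exists_subset x Set.univ isOpen_univ (Set.mem_univ _)).choose_spec.1
  chart_mem_atlas _ := Set.mem_range_self _
  open_source := by
    rintro _ _ ⟨i, rfl⟩ ⟨j, rfl⟩
    refine isOpen_iff_mem_nhds.2 fun z hz => ?_
    obtain ⟨t, -, -, h3⟩ := h.trans_aux i j hz
    exact h3
  continuousOn_toFun := by
    rintro _ _ ⟨i, rfl⟩ ⟨j, rfl⟩ z hz
    obtain ⟨t, h1, h2, -⟩ := h.trans_aux i j hz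
    exact (h1.continuousAt.congr h2.symm).continuousWithinAt

end IsCoordinateSystem

/-- The topology is the one defined by the charts, and `f` is continuous because the `V i` are
arbitrarily small. Hausdorff: points with different images are separated by `f`, and points with the
same image lie in a common chart. Second countable: countably many `V i` have the same union as all
of them, and each chart domain is homeomorphic to an open subset of `H`. -/
theorem IsCoordinateSystem.exists_chartedSpace [FiniteDimensional ℝ H] [T2Space Y]
    [SecondCountableTopology Y] {f : X → Y} {V : ι → Set Y} {T : ι → Set H} {c : ι → X → H}
    (h : IsCoordinateSystem f V T c) (hne : ι → Nonempty X) :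
    ∃ (_ : TopologicalSpace X) (_ : ChartedSpace H X), IsSmoothManifold H X ∧ Continuous f ∧
      ∀ i, ∃ e ∈ IsManifold.maximalAtlas 𝓘(ℝ, H) ∞ X, e.source = f ⁻¹' V i ∧
        ∀ x, e x = c i x := by
  -- A chart carries a total inverse function `H → X`, so an empty `X` has none; `hne` then says
  -- that there are no indices.
  rcases isEmpty_or_nonempty X with hX | hX
  · let _ : TopologicalSpace X := ⊥
    have : DiscreteTopology X := ⟨rfl⟩
    let _ : ChartedSpace H X := ChartedSpace.empty H X
    refine ⟨inferInstance, inferInstance, ⟨inferInstance, ?_, inferInstance, inferInstance⟩,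
      continuous_of_discreteTopology, fun i => (not_nonempty_iff.2 hX (hne i)).elim⟩
    exact isManifold_of_contDiffOn _ _ _ fun e _ he => he.elim
  let _ : TopologicalSpace X := h.core.toTopologicalSpace
  let _ : ChartedSpace H X := h.core.toChartedSpace
  let e (i : ι) : OpenPartialHomeomorph X H :=
    h.core.openPartialHomeomorph (h.chart i) (Set.mem_range_self i)
  have he : ∀ i, e i ∈ atlas H X := fun i =>
    Set.mem_iUnion₂.2 ⟨h.chart i, Set.mem_range_self i, rfl⟩
  have hatlas : ∀ e' ∈ atlas H X, ∃ i, e' = e i := by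
    intro e' he'
    obtain ⟨E, ⟨i, rfl⟩, hE⟩ := Set.mem_iUnion₂.1 he'
    exact ⟨i, hE⟩
  have hman : IsManifold 𝓘(ℝ, H) ∞ X := by
    refine isManifold_of_contDiffOn _ _ _ fun e₁ e₂ h₁ h₂ => ?_
    obtain ⟨i, rfl⟩ := hatlas _ h₁
    obtain ⟨j, rfl⟩ := hatlas _ h₂
    rintro z ⟨hz, -⟩
    obtain ⟨t, h1, h2, -⟩ := h.trans_aux i j (z := z) hz
    exact (h1.congr_of_eventuallyEq h2).contDiffWithinAt
  have hsource : ∀ i, IsOpen (f ⁻¹' V i) := fun i => (e i).open_source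
  have hcont : Continuous f := by
    refine continuous_def.2 fun W hW => isOpen_iff_mem_nhds.2 fun x hx => ?_
    obtain ⟨i, hi, hiW⟩ := h.exists_subset x W hW hx
    exact Filter.mem_of_superset ((hsource i).mem_nhds hi) (Set.preimage_mono hiW)
  refine ⟨inferInstance, inferInstance, ⟨inferInstance, hman, ?_, ?_⟩, hcont, fun i =>
    ⟨e i, IsManifold.subset_maximalAtlas (he i), rfl, fun _ => rfl⟩⟩
  · refine (t2Space_iff X).2 fun x y hxy => ?_
    by_cases hf : f x = f y
    · obtain ⟨i, hi, -⟩ := h.exists_subset x Set.univ isOpen_univ (Set.mem_univ _)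
      have hj : y ∈ (e i).source := show f y ∈ V i from hf ▸ hi
      obtain ⟨u, v, hu, hv, hxu, hyv, huv⟩ := t2_separation ((e i).injOn.ne hi hj hxy)
      exact ⟨_, _, (e i).isOpen_inter_preimage hu, (e i).isOpen_inter_preimage hv, ⟨hi, hxu⟩,
        ⟨hj, hyv⟩, (huv.preimage (e i)).mono Set.inter_subset_right Set.inter_subset_right⟩
    · obtain ⟨u, v, hu, hv, hxu, hyv, huv⟩ := t2_separation hf
      exact ⟨_, _, hu.preimage hcont, hv.preimage hcont, hxu, hyv, huv.preimage f⟩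
  · obtain ⟨S, hS, hSU⟩ := TopologicalSpace.isOpen_iUnion_countable V h.isOpen_base
    have := hS.to_subtype
    have (i : S) : SecondCountableTopology (f ⁻¹' V i) :=
      (e i).secondCountableTopology_source
    refine TopologicalSpace.secondCountableTopology_of_countable_cover (U := fun i : S => f ⁻¹' V i)
      (fun i => hsource i) (Set.eq_univ_of_forall fun x => ?_)
    obtain ⟨i, hi, -⟩ := h.exists_subset x Set.univ isOpen_univ (Set.mem_univ _)
    have : f x ∈ ⋃ i ∈ S, V i := hSU ▸ Set.mem_iUnion.2 ⟨i, hi⟩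
    obtain ⟨j, hj, hxj⟩ := Set.mem_iUnion₂.1 this
    exact Set.mem_iUnion.2 ⟨⟨j, hj⟩, hxj⟩

end Coordinates

/-! ### Jets of maps from a normed space to a manifold -/

section ManifoldSameJet

variable {E E' F F' N N' : Type*} [NormedAddCommGroup E] [NormedSpace ℝ E]
  [NormedAddCommGroup E'] [NormedSpace ℝ E']
  [NormedAddCommGroup F] [NormedSpace ℝ F] [NormedAddCommGroup F'] [NormedSpace ℝ F']
  [TopologicalSpace N] [ChartedSpace F N] [TopologicalSpace N'] [ChartedSpace F' N']

theorem ContMDiffAt.contDiffAt_maximalAtlas_comp {χ : OpenPartialHomeomorph N F}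
    (hχ : χ ∈ IsManifold.maximalAtlas 𝓘(ℝ, F) ∞ N) {a : E → N} {x : E}
    (ha : ContMDiffAt 𝓘(ℝ, E) 𝓘(ℝ, F) ∞ a x) (hx : a x ∈ χ.source) :
    ContDiffAt ℝ ∞ (fun y => χ (a y)) x :=
  ((contMDiffAt_of_mem_maximalAtlas hχ hx).comp x ha).contDiffAt

/-- Near `x`, `f` is `χ.symm` applied to `χ ∘ f`. The hypothesis `hx` replaces continuity of `f`,
which is not known beforehand. -/
theorem ContMDiffAt.of_maximalAtlas_comp {H₀ E₀ X : Type*} [NormedAddCommGroup E₀]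
    [NormedSpace ℝ E₀] [TopologicalSpace H₀] {I : ModelWithCorners ℝ E₀ H₀} [TopologicalSpace X]
    [ChartedSpace H₀ X] {χ : OpenPartialHomeomorph N F}
    (hχ : χ ∈ IsManifold.maximalAtlas 𝓘(ℝ, F) ∞ N) {f : X → N} {x : X}
    (hx : ∀ᶠ y in 𝓝 x, f y ∈ χ.source)
    (hf : ContMDiffAt I 𝓘(ℝ, F) ∞ (fun y => χ (f y)) x) : ContMDiffAt I 𝓘(ℝ, F) ∞ f x := by
  refine ((contMDiffAt_symm_of_mem_maximalAtlas hχ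
    (χ.map_source hx.self_of_nhds)).comp x hf).congr_of_eventuallyEq ?_
  filter_upwards [hx] with y hy using (χ.left_inv hy).symm

variable (F) in
/-- Two maps to a manifold have the same `r`-jet at a point. -/
def SameJetInCharts (r : ℕ) (f g : E → N) (x : E) : Prop :=
  f x = g x ∧ SameJet r (fun y => chartAt F (f x) (f y)) (fun y => chartAt F (f x) (g y)) x

namespace SameJetInCharts

variable {r : ℕ} {f g h : E → N} {x : E}

theorem refl (f : E → N) (x : E) : SameJetInCharts F r f f x := ⟨rfl, SameJet.rfl⟩

theorem symm (H : SameJetInCharts F r f g x) : SameJetInCharts F r g f x :=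
  ⟨H.1.symm, H.1 ▸ H.2.symm⟩

theorem trans (H : SameJetInCharts F r f g x) (H' : SameJetInCharts F r g h x) :
    SameJetInCharts F r f h x :=
  ⟨H.1.trans H'.1, H.2.trans (by rw [H.1]; exact H'.2)⟩

theorem of_eventuallyEq (H : f =ᶠ[𝓝 x] g) : SameJetInCharts F r f g x :=
  ⟨H.self_of_nhds, SameJet.of_eventuallyEq (H.mono fun _ hy => congrArg _ hy)⟩

theorem congr {f' g' : E → N} (H : SameJetInCharts F r f g x) (hf : f' =ᶠ[𝓝 x] f)
    (hg : g' =ᶠ[𝓝 x] g) : SameJetInCharts F r f' g' x :=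
  (of_eventuallyEq hf).trans (H.trans (of_eventuallyEq hg.symm))

theorem iff_sameJet {f g : E → F} : SameJetInCharts F r f g x ↔ SameJet r f g x := by
  simp only [SameJetInCharts, chartAt_self_eq, OpenPartialHomeomorph.refl_apply]
  exact ⟨fun H => H.2, fun H => ⟨H.apply_eq, H⟩⟩

/-- Reading `A` in the charts at `f (B y)` and at its image reduces this to `SameJet.comp`; by
continuity the chart and its inverse cancel near `y`. -/
theorem comp [IsManifold 𝓘(ℝ, F) ∞ N] [IsManifold 𝓘(ℝ, F') ∞ N'] {A : N → N'} {B : E' → E} {y : E'}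
    (H : SameJetInCharts F r f g (B y))
    (hf : ContMDiffAt 𝓘(ℝ, E) 𝓘(ℝ, F) ∞ f (B y)) (hg : ContMDiffAt 𝓘(ℝ, E) 𝓘(ℝ, F) ∞ g (B y))
    (hA : ContMDiffAt 𝓘(ℝ, F) 𝓘(ℝ, F') ∞ A (f (B y))) (hB : ContDiffAt ℝ ∞ B y) :
    SameJetInCharts F' r (fun z => A (f (B z))) (fun z => A (g (B z))) y := by
  refine ⟨congrArg A H.1, ?_⟩
  set p := f (B y) with hp
  have hpg : g (B y) = p := H.1.symm
  let χ := chartAt F p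
  let χ' := chartAt F' (A p)
  have hχ : χ ∈ IsManifold.maximalAtlas 𝓘(ℝ, F) ∞ N := IsManifold.chart_mem_maximalAtlas p
  have hpχ : p ∈ χ.source := mem_chart_source F p
  have hχ' : χ' ∈ IsManifold.maximalAtlas 𝓘(ℝ, F') ∞ N' := IsManifold.chart_mem_maximalAtlas _
  have hA' : ContDiffAt ℝ ∞ (fun z => χ' (A (χ.symm z))) (χ p) := by
    refine ContMDiffAt.contDiffAt_maximalAtlas_comp hχ' ?_ ?_
    · refine ContMDiffAt.comp (χ p) ?_ (contMDiffAt_symm_of_mem_maximalAtlas hχ (χ.map_source hpχ))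
      rwa [χ.left_inv hpχ]
    · rw [χ.left_inv hpχ]
      exact mem_chart_source F' (A p)
  have key := SameJet.comp (B := B) (A := fun z => χ' (A (χ.symm z))) H.2
    (hf.contDiffAt_maximalAtlas_comp hχ hpχ)
    (hg.contDiffAt_maximalAtlas_comp hχ (by rwa [hpg])) (by rwa [← hp]) hB
  have hev : ∀ {k : E → N}, ContMDiffAt 𝓘(ℝ, E) 𝓘(ℝ, F) ∞ k (B y) → k (B y) = p →
      (fun z => χ' (A (k (B z)))) =ᶠ[𝓝 y] fun z => χ' (A (χ.symm (χ (k (B z))))) := by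
    intro k hk hkp
    have hc : ContinuousAt (fun z => k (B z)) y := hk.continuousAt.comp hB.continuousAt
    have hkχ : k (B y) ∈ χ.source := hkp.symm ▸ hpχ
    filter_upwards [hc.eventually (χ.open_source.mem_nhds hkχ)] with z hz
    rw [χ.left_inv hz]
  exact key.congr (hev hf hp.symm) (hev hg hpg)

theorem comp_left [IsManifold 𝓘(ℝ, F) ∞ N] [IsManifold 𝓘(ℝ, F') ∞ N'] {A : N → N'}
    (H : SameJetInCharts F r f g x)
    (hf : ContMDiffAt 𝓘(ℝ, E) 𝓘(ℝ, F) ∞ f x) (hg : ContMDiffAt 𝓘(ℝ, E) 𝓘(ℝ, F) ∞ g x)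
    (hA : ContMDiffAt 𝓘(ℝ, F) 𝓘(ℝ, F') ∞ A (f x)) :
    SameJetInCharts F' r (fun z => A (f z)) (fun z => A (g z)) x :=
  comp (B := fun z => z) H hf hg hA contDiffAt_id

theorem sameJet [IsManifold 𝓘(ℝ, F) ∞ N] {A : N → F'} (H : SameJetInCharts F r f g x)
    (hf : ContMDiffAt 𝓘(ℝ, E) 𝓘(ℝ, F) ∞ f x) (hg : ContMDiffAt 𝓘(ℝ, E) 𝓘(ℝ, F) ∞ g x)
    (hA : ContMDiffAt 𝓘(ℝ, F) 𝓘(ℝ, F') ∞ A (f x)) :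
    SameJet r (fun z => A (f z)) (fun z => A (g z)) x :=
  iff_sameJet.1 (H.comp_left hf hg hA)

end SameJetInCharts

theorem SameJet.inCharts [IsManifold 𝓘(ℝ, F') ∞ N'] {r : ℕ} {f g : E → F} {x : E} {A : F → N'}
    (H : SameJet r f g x) (hf : ContDiffAt ℝ ∞ f x) (hg : ContDiffAt ℝ ∞ g x)
    (hA : ContMDiffAt 𝓘(ℝ, F) 𝓘(ℝ, F') ∞ A (f x)) :
    SameJetInCharts F' r (fun z => A (f z)) (fun z => A (g z)) x :=
  (SameJetInCharts.iff_sameJet.2 H).comp_left hf.contMDiffAt hg.contMDiffAt hA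

/-- Chart independence: `χ` and its inverse are smooth maps, and composing with either preserves
equality of jets. -/
theorem sameJetInCharts_iff_of_mem_maximalAtlas [IsManifold 𝓘(ℝ, F) ∞ N] {r : ℕ} {f g : E → N}
    {x : E} {χ : OpenPartialHomeomorph N F} (hχ : χ ∈ IsManifold.maximalAtlas 𝓘(ℝ, F) ∞ N)
    (hf : ContMDiffAt 𝓘(ℝ, E) 𝓘(ℝ, F) ∞ f x) (hg : ContMDiffAt 𝓘(ℝ, E) 𝓘(ℝ, F) ∞ g x)
    (hfχ : f x ∈ χ.source) (hgχ : g x ∈ χ.source) :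
    SameJetInCharts F r f g x ↔ SameJet r (fun z => χ (f z)) (fun z => χ (g z)) x := by
  refine ⟨fun H => H.sameJet hf hg (contMDiffAt_of_mem_maximalAtlas hχ hfχ), fun H => ?_⟩
  have H' := H.inCharts (hf.contDiffAt_maximalAtlas_comp hχ hfχ)
    (hg.contDiffAt_maximalAtlas_comp hχ hgχ)
    (contMDiffAt_symm_of_mem_maximalAtlas hχ (χ.map_source hfχ))
  refine H'.congr ?_ ?_
  · filter_upwards [hf.continuousAt.eventually (χ.open_source.mem_nhds hfχ)] with z hz
    rw [χ.left_inv hz]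
  · filter_upwards [hg.continuousAt.eventually (χ.open_source.mem_nhds hgχ)] with z hz
    rw [χ.left_inv hz]

/-- A smooth binary operation, read in charts. -/
theorem contDiffAt_binop_inCharts {B : N → N → N}
    (hB : ContMDiff (𝓘(ℝ, F).prod 𝓘(ℝ, F)) 𝓘(ℝ, F) ∞ fun z : N × N => B z.1 z.2)
    {χa χb χc : OpenPartialHomeomorph N F} (ha : χa ∈ IsManifold.maximalAtlas 𝓘(ℝ, F) ∞ N)
    (hb : χb ∈ IsManifold.maximalAtlas 𝓘(ℝ, F) ∞ N)
    (hc : χc ∈ IsManifold.maximalAtlas 𝓘(ℝ, F) ∞ N) {z : F × F} (hza : z.1 ∈ χa.target)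
    (hzb : z.2 ∈ χb.target) (hz : B (χa.symm z.1) (χb.symm z.2) ∈ χc.source) :
    ContDiffAt ℝ ∞ (fun w : F × F => χc (B (χa.symm w.1) (χb.symm w.2))) z := by
  refine ContMDiffAt.contDiffAt_maximalAtlas_comp hc ?_ hz
  have h1 : ContMDiffAt 𝓘(ℝ, F × F) 𝓘(ℝ, F) ∞ (fun w : F × F => χa.symm w.1) z :=
    (contMDiffAt_symm_of_mem_maximalAtlas ha hza).comp z contDiff_fst.contMDiff.contMDiffAt
  have h2 : ContMDiffAt 𝓘(ℝ, F × F) 𝓘(ℝ, F) ∞ (fun w : F × F => χb.symm w.2) z :=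
    (contMDiffAt_symm_of_mem_maximalAtlas hb hzb).comp z contDiff_snd.contMDiff.contMDiffAt
  exact (hB _).comp z (h1.prodMk h2)

/-- The operation, read in charts, is composed with the pair of local representatives. This makes
the pointwise product well defined on jets. -/
theorem SameJetInCharts.map₂ [IsManifold 𝓘(ℝ, F) ∞ N] {B : N → N → N}
    (hB : ContMDiff (𝓘(ℝ, F).prod 𝓘(ℝ, F)) 𝓘(ℝ, F) ∞ fun z : N × N => B z.1 z.2)
    {r : ℕ} {f g f' g' : E → N} {x : E}
    (H : SameJetInCharts F r f g x) (H' : SameJetInCharts F r f' g' x)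
    (hf : ContMDiffAt 𝓘(ℝ, E) 𝓘(ℝ, F) ∞ f x) (hg : ContMDiffAt 𝓘(ℝ, E) 𝓘(ℝ, F) ∞ g x)
    (hf' : ContMDiffAt 𝓘(ℝ, E) 𝓘(ℝ, F) ∞ f' x) (hg' : ContMDiffAt 𝓘(ℝ, E) 𝓘(ℝ, F) ∞ g' x) :
    SameJetInCharts F r (fun y => B (f y) (f' y)) (fun y => B (g y) (g' y)) x := by
  let χa := chartAt F (f x)
  let χb := chartAt F (f' x)
  let χc := chartAt F (B (f x) (f' x))
  have ha : f x ∈ χa.source := mem_chart_source F _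
  have hb : f' x ∈ χb.source := mem_chart_source F _
  have ha' : g x ∈ χa.source := H.1 ▸ ha
  have hb' : g' x ∈ χb.source := H'.1 ▸ hb
  have hχ (p : N) : chartAt F p ∈ IsManifold.maximalAtlas 𝓘(ℝ, F) ∞ N :=
    IsManifold.chart_mem_maximalAtlas p
  have hA := contDiffAt_binop_inCharts hB (χc := χc) (hχ _) (hχ _) (hχ _)
    (z := (χa (f x), χb (f' x))) (χa.map_source ha) (χb.map_source hb) (by
      dsimp only
      rw [χa.left_inv ha, χb.left_inv hb]
      exact mem_chart_source F _)
  have cf := hf.contDiffAt_maximalAtlas_comp (hχ _) ha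
  have cg := hg.contDiffAt_maximalAtlas_comp (hχ _) ha'
  have cf' := hf'.contDiffAt_maximalAtlas_comp (hχ _) hb
  have cg' := hg'.contDiffAt_maximalAtlas_comp (hχ _) hb'
  refine ⟨congrArg₂ B H.1 H'.1, ((H.2.prodMk H'.2 cf cg cf' cg').comp_left (cf.prodMk cf')
    (cg.prodMk cg') hA).congr ?_ ?_⟩
  · filter_upwards [hf.continuousAt.eventually (χa.open_source.mem_nhds ha),
      hf'.continuousAt.eventually (χb.open_source.mem_nhds hb)] with z hz hz'
    rw [χa.left_inv hz, χb.left_inv hz']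
  · filter_upwards [hg.continuousAt.eventually (χa.open_source.mem_nhds ha'),
      hg'.continuousAt.eventually (χb.open_source.mem_nhds hb')] with z hz hz'
    rw [χa.left_inv hz, χb.left_inv hz']

end ManifoldSameJet

/-! ### The Lie group of jets at the origin of maps from a normed space to a Lie group -/

section JetGroup

variable (E F G : Type*) [NormedAddCommGroup E] [NormedSpace ℝ E]
  [NormedAddCommGroup F] [NormedSpace ℝ F] [TopologicalSpace G] [ChartedSpace F G] [Group G]
  [LieGroup 𝓘(ℝ, F) ∞ G]

/-- The group of maps to a Lie group that are smooth near the origin. -/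
def smoothNearZero : Subgroup (E → G) where
  -- Smoothness at the origin alone would allow the neighbourhood to shrink with the order of
  -- differentiability; a local section needs one neighbourhood for all orders.
  carrier := {a | ∀ᶠ y in 𝓝 0, ContMDiffAt 𝓘(ℝ, E) 𝓘(ℝ, F) ∞ a y}
  mul_mem' ha hb := by
    filter_upwards [ha, hb] with y h h' using h.mul h'
  one_mem' := Filter.Eventually.of_forall fun _ => contMDiffAt_const
  inv_mem' ha := by
    filter_upwards [ha] with y h using h.inv

variable {E F G} in
theorem contMDiffAt_smoothNearZero (a : smoothNearZero E F G) :
    ContMDiffAt 𝓘(ℝ, E) 𝓘(ℝ, F) ∞ (a : E → G) 0 :=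
  (show ∀ᶠ y in 𝓝 0, ContMDiffAt 𝓘(ℝ, E) 𝓘(ℝ, F) ∞ (a : E → G) y from a.2).self_of_nhds

/-- Equality of jets at the origin is compatible with pointwise multiplication. -/
def jetCon (r : ℕ) : Con (smoothNearZero E F G) where
  r a b := SameJetInCharts F r (a : E → G) (b : E → G) 0
  iseqv := ⟨fun a => .refl a.1 0, .symm, .trans⟩
  mul' {a b c d} hab hcd :=
    have : IsManifold 𝓘(ℝ, F) ∞ G := ContMDiffMul.toIsManifold
    SameJetInCharts.map₂ (B := fun x y : G => x * y) (contMDiff_mul 𝓘(ℝ, F) ∞) hab hcd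
      (contMDiffAt_smoothNearZero a) (contMDiffAt_smoothNearZero b) (contMDiffAt_smoothNearZero c) (contMDiffAt_smoothNearZero d)

/-- The group of `r`-jets at the origin of maps from `E` to the Lie group `G`. -/
def JetGroup (r : ℕ) : Type _ := (jetCon E F G r).Quotient

instance (r : ℕ) : Group (JetGroup E F G r) := inferInstanceAs (Group (jetCon E F G r).Quotient)

end JetGroup

namespace JetGroup

variable {E F G : Type*} [NormedAddCommGroup E] [NormedSpace ℝ E]
  [NormedAddCommGroup F] [NormedSpace ℝ F] [TopologicalSpace G] [ChartedSpace F G] [Group G]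
  [LieGroup 𝓘(ℝ, F) ∞ G] {r : ℕ}

/-- The jet of a map that is smooth near the origin. -/
def mk : smoothNearZero E F G →* JetGroup E F G r := (jetCon E F G r).mk'

theorem mk_eq_mk_iff {a b : smoothNearZero E F G} :
    (mk a : JetGroup E F G r) = mk b ↔ SameJetInCharts F r (a : E → G) (b : E → G) 0 :=
  (jetCon E F G r).eq

/-- A representative of a jet. -/
def rep (γ : JetGroup E F G r) : smoothNearZero E F G := Quotient.out γ

theorem mk_rep (γ : JetGroup E F G r) : mk γ.rep = γ := Quotient.out_eq γ

theorem rep_mk (a : smoothNearZero E F G) :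
    SameJetInCharts F r ((mk a : JetGroup E F G r).rep : E → G) a 0 :=
  mk_eq_mk_iff.1 (mk_rep _)

theorem mk_congr {a b : smoothNearZero E F G} (h : (a : E → G) =ᶠ[𝓝 0] b) :
    (mk a : JetGroup E F G r) = mk b :=
  mk_eq_mk_iff.2 (.of_eventuallyEq h)

/-- The value of a jet at the origin. -/
def val (γ : JetGroup E F G r) : G := γ.rep.1 0

theorem val_mk (a : smoothNearZero E F G) : (mk a : JetGroup E F G r).val = a.1 0 := (rep_mk a).1

theorem val_div (γ δ : JetGroup E F G r) : (γ / δ).val = γ.val / δ.val := by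
  rw [← mk_rep γ, ← mk_rep δ, ← map_div, val_mk, val_mk, val_mk]
  rfl

/-- The coordinates of a jet in a chart of the group. -/
def coord (χ : OpenPartialHomeomorph G F) (γ : JetGroup E F G r) : JetFiberModel E F r :=
  JetFiberModel.of r (fun y => χ (γ.rep.1 y)) 0

variable {χ : OpenPartialHomeomorph G F}

/-- Chart independence frees `coord` from the chosen representative. -/
theorem coord_mk (hχ : χ ∈ IsManifold.maximalAtlas 𝓘(ℝ, F) ∞ G) {a : smoothNearZero E F G}
    (ha : a.1 0 ∈ χ.source) :
    coord χ (mk a : JetGroup E F G r) = JetFiberModel.of r (fun y => χ (a.1 y)) 0 := by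
  have : IsManifold 𝓘(ℝ, F) ∞ G := ContMDiffMul.toIsManifold
  have h := rep_mk (r := r) a
  have h' : (mk a : JetGroup E F G r).rep.1 0 ∈ χ.source := h.1.symm ▸ ha
  refine (JetFiberModel.of_eq_of_iff_sameJet ?_ ?_).2
    ((sameJetInCharts_iff_of_mem_maximalAtlas hχ ?_ ?_ h' ha).1 h)
  · exact (contMDiffAt_smoothNearZero _).contDiffAt_maximalAtlas_comp hχ h'
  · exact (contMDiffAt_smoothNearZero a).contDiffAt_maximalAtlas_comp hχ ha
  · exact contMDiffAt_smoothNearZero _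
  · exact (contMDiffAt_smoothNearZero a)

theorem value_coord (hχ : χ ∈ IsManifold.maximalAtlas 𝓘(ℝ, F) ∞ G) {γ : JetGroup E F G r}
    (hγ : γ.val ∈ χ.source) : (coord χ γ).value = χ γ.val :=
  JetFiberModel.value_of ((contMDiffAt_smoothNearZero γ.rep).contDiffAt_maximalAtlas_comp hχ hγ)

theorem coord_injOn (hχ : χ ∈ IsManifold.maximalAtlas 𝓘(ℝ, F) ∞ G) :
    Set.InjOn (coord (r := r) (E := E) χ) (val ⁻¹' χ.source) := by
  have : IsManifold 𝓘(ℝ, F) ∞ G := ContMDiffMul.toIsManifold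
  intro γ hγ δ hδ h
  rw [← mk_rep γ, ← mk_rep δ]
  refine mk_eq_mk_iff.2 ((sameJetInCharts_iff_of_mem_maximalAtlas hχ (contMDiffAt_smoothNearZero γ.rep)
    (contMDiffAt_smoothNearZero δ.rep) hγ hδ).2 ?_)
  exact (JetFiberModel.of_eq_of_iff_sameJet
    ((contMDiffAt_smoothNearZero γ.rep).contDiffAt_maximalAtlas_comp hχ hγ)
    ((contMDiffAt_smoothNearZero δ.rep).contDiffAt_maximalAtlas_comp hχ hδ)).1 h

variable [FiniteDimensional ℝ F]

/-- The map with given Taylor polynomial in a chart. -/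
def ofCoord (hχ : χ ∈ IsManifold.maximalAtlas 𝓘(ℝ, F) ∞ G) (p : JetFiberModel E F r)
    (hp : p.value ∈ χ.target) : smoothNearZero E F G :=
  ⟨fun y => χ.symm (p.taylor y), by
    have hc : ContDiff ℝ ∞ p.taylor := p.contDiff_taylor_right.of_le le_top
    have h0 : p.taylor 0 ∈ χ.target := by rwa [p.taylor_zero]
    filter_upwards [hc.continuous.continuousAt.eventually (χ.open_target.mem_nhds h0)] with y hy
    exact (contMDiffAt_symm_of_mem_maximalAtlas hχ hy).comp y hc.contMDiff.contMDiffAt⟩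

theorem val_mk_ofCoord (hχ : χ ∈ IsManifold.maximalAtlas 𝓘(ℝ, F) ∞ G) (p : JetFiberModel E F r)
    (hp : p.value ∈ χ.target) :
    (mk (ofCoord hχ p hp) : JetGroup E F G r).val = χ.symm p.value := by
  rw [val_mk, ← p.taylor_zero]
  rfl

theorem coord_mk_ofCoord (hχ : χ ∈ IsManifold.maximalAtlas 𝓘(ℝ, F) ∞ G) (p : JetFiberModel E F r)
    (hp : p.value ∈ χ.target) : coord χ (mk (ofCoord hχ p hp) : JetGroup E F G r) = p := by
  have h := val_mk_ofCoord hχ p hp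
  rw [val_mk] at h
  rw [coord_mk hχ (h ▸ χ.map_target hp)]
  refine Eq.trans (JetFiberModel.of_congr ?_) p.of_taylor
  have h0 : p.taylor 0 ∈ χ.target := by rwa [p.taylor_zero]
  filter_upwards [p.contDiff_taylor_right.continuous.continuousAt.eventually
    (χ.open_target.mem_nhds h0)] with y hy
  exact χ.right_inv hy

/-- Normal form: a jet is represented by its own Taylor polynomial in a chart, since both have the
same coordinates and these are injective. -/
theorem eq_mk_ofCoord (hχ : χ ∈ IsManifold.maximalAtlas 𝓘(ℝ, F) ∞ G) {γ : JetGroup E F G r}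
    (hγ : γ.val ∈ χ.source) {p : JetFiberModel E F r} (hp : coord χ γ = p) :
    ∃ hp : p.value ∈ χ.target, γ = mk (ofCoord hχ p hp) := by
  subst hp
  have hp : (coord χ γ).value ∈ χ.target := by
    rw [value_coord hχ hγ]
    exact χ.map_source hγ
  refine ⟨hp, coord_injOn hχ hγ ?_ (coord_mk_ofCoord hχ _ hp).symm⟩
  rw [Set.mem_preimage, val_mk_ofCoord]
  exact χ.map_target hp

/-- Replacing both jets by their Taylor polynomials makes the quotient an explicit function of the
coordinates, to which `contDiffAt_coord_binop` applies. -/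
theorem coord_div {χa χb χc : OpenPartialHomeomorph G F}
    (ha : χa ∈ IsManifold.maximalAtlas 𝓘(ℝ, F) ∞ G)
    (hb : χb ∈ IsManifold.maximalAtlas 𝓘(ℝ, F) ∞ G)
    (hc : χc ∈ IsManifold.maximalAtlas 𝓘(ℝ, F) ∞ G) {γ δ : JetGroup E F G r}
    (hγ : γ.val ∈ χa.source) (hδ : δ.val ∈ χb.source) (hγδ : (γ / δ).val ∈ χc.source) :
    coord χc (γ / δ) = JetFiberModel.of r (fun y => χc (χa.symm ((coord χa γ).taylor y) /
      χb.symm ((coord χb δ).taylor y))) 0 := by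
  obtain ⟨hp, h1⟩ := eq_mk_ofCoord ha hγ rfl
  obtain ⟨hq, h2⟩ := eq_mk_ofCoord hb hδ rfl
  have h : γ / δ = mk (ofCoord ha _ hp / ofCoord hb _ hq) := by rw [map_div, ← h1, ← h2]
  rw [h, val_mk] at hγδ
  rw [h, coord_mk hc hγδ]
  rfl

variable [FiniteDimensional ℝ E]

/-- A smooth binary operation in jet coordinates. -/
theorem contDiffAt_coord_binop {B : G → G → G}
    (hB : ContMDiff (𝓘(ℝ, F).prod 𝓘(ℝ, F)) 𝓘(ℝ, F) ∞ fun z : G × G => B z.1 z.2)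
    {χa χb χc : OpenPartialHomeomorph G F} (ha : χa ∈ IsManifold.maximalAtlas 𝓘(ℝ, F) ∞ G)
    (hb : χb ∈ IsManifold.maximalAtlas 𝓘(ℝ, F) ∞ G)
    (hc : χc ∈ IsManifold.maximalAtlas 𝓘(ℝ, F) ∞ G) {γ δ : JetGroup E F G r}
    (hγ : γ.val ∈ χa.source) (hδ : δ.val ∈ χb.source) (hγδ : B γ.val δ.val ∈ χc.source) :
    ContDiffAt ℝ ∞ (fun q : JetFiberModel E F r × JetFiberModel E F r =>
      JetFiberModel.of r (fun y => χc (B (χa.symm (q.1.taylor y)) (χb.symm (q.2.taylor y)))) 0)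
      (coord χa γ, coord χb δ) := by
  refine JetFiberModel.contDiffAt_of (c := fun _ => (0 : E))
    (H := fun w : (JetFiberModel E F r × JetFiberModel E F r) × E =>
      χc (B (χa.symm (w.1.1.taylor w.2)) (χb.symm (w.1.2.taylor w.2)))) ?_ contDiffAt_const
  have hA := contDiffAt_binop_inCharts hB ha hb hc (z := (χa γ.val, χb δ.val))
    (χa.map_source hγ) (χb.map_source hδ) (by
      dsimp only
      rwa [χa.left_inv hγ, χb.left_inv hδ])
  have ht : ContDiff ℝ ∞ (fun z : JetFiberModel E F r × E => z.1.taylor z.2) :=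
    JetFiberModel.contDiff_taylor.of_le le_top
  have h1 : ContDiff ℝ ∞ (fun w : (JetFiberModel E F r × JetFiberModel E F r) × E =>
      (w.1.1.taylor w.2, w.1.2.taylor w.2)) :=
    (ht.comp ((contDiff_fst.comp contDiff_fst).prodMk contDiff_snd)).prodMk
      (ht.comp ((contDiff_snd.comp contDiff_fst).prodMk contDiff_snd))
  refine ContDiffAt.comp _ (g := fun w : F × F => χc (B (χa.symm w.1) (χb.symm w.2)))
    (f := fun w : (JetFiberModel E F r × JetFiberModel E F r) × E =>
      (w.1.1.taylor w.2, w.1.2.taylor w.2)) ?_ h1.contDiffAt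
  simpa only [JetFiberModel.taylor_zero, value_coord ha hγ, value_coord hb hδ] using hA

theorem isCoordinateSystem : IsCoordinateSystem (val : JetGroup E F G r → G)
    (fun χ : {χ // χ ∈ IsManifold.maximalAtlas 𝓘(ℝ, F) ∞ G} => χ.1.source)
    (fun χ => JetFiberModel.value ⁻¹' χ.1.target) (fun χ => coord χ.1) where
  isOpen_base χ := χ.1.open_source
  isOpen_target χ := χ.1.open_target.preimage JetFiberModel.value.continuous
  bijOn χ := by
    refine ⟨fun γ hγ => ?_, coord_injOn χ.2, fun p hp => ⟨mk (ofCoord χ.2 p hp), ?_,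
      coord_mk_ofCoord χ.2 p hp⟩⟩
    · rw [Set.mem_preimage, value_coord χ.2 hγ]
      exact χ.1.map_source hγ
    · rw [Set.mem_preimage, val_mk_ofCoord]
      exact χ.1.map_target hp
  exists_subset γ W hW hγ := by
    have : IsManifold 𝓘(ℝ, F) ∞ G := ContMDiffMul.toIsManifold
    refine ⟨⟨(chartAt F γ.val).restr W, restr_mem_maximalAtlas _
      (IsManifold.chart_mem_maximalAtlas _) hW⟩, ?_, ?_⟩
    · rw [(chartAt F γ.val).restr_source' _ hW]
      exact ⟨mem_chart_source F _, hγ⟩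
    · dsimp only
      rw [(chartAt F γ.val).restr_source' _ hW]
      exact Set.inter_subset_right
  transition χ χ' γ hγ hγ' := by
    refine ⟨fun p => JetFiberModel.of r (fun y => χ'.1 (χ.1.symm (p.taylor y))) 0, ?_, ?_⟩
    -- A change of charts is the binary operation `B a b = a`, restricted to the diagonal.
    · exact (contDiffAt_coord_binop (B := fun a _ => a) contMDiff_fst χ.2 χ.2 χ'.2 hγ hγ hγ').comp
        (coord χ.1 γ) (f := fun p => (p, p)) (contDiffAt_id.prodMk contDiffAt_id)
    · have h0 : (coord χ.1 γ).value ∈ χ.1.target ∩ χ.1.symm ⁻¹' χ'.1.source := by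
        rw [value_coord χ.2 hγ]
        refine ⟨χ.1.map_source hγ, ?_⟩
        rwa [Set.mem_preimage, χ.1.left_inv hγ]
      filter_upwards [JetFiberModel.value.continuous.continuousAt.eventually
        ((χ.1.symm.isOpen_inter_preimage χ'.1.open_source).mem_nhds h0)] with p hp δ hδ hδp
      obtain ⟨hp', rfl⟩ := eq_mk_ofCoord χ.2 hδ hδp
      have hv := val_mk_ofCoord χ.2 p hp'
      have hv' : (mk (ofCoord χ.2 p hp') : JetGroup E F G r).val ∈ χ'.1.source := by
        rw [hv]
        exact hp.2
      refine ⟨hv', ?_⟩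
      rw [val_mk] at hv'
      exact coord_mk χ'.2 hv'

/-- The jets at the origin form a Lie group. -/
theorem exists_lieGroup (hG : IsSmoothManifold F G) (r : ℕ) :
    ∃ (_ : TopologicalSpace (JetGroup E F G r))
      (_ : ChartedSpace (JetFiberModel E F r) (JetGroup E F G r)),
      IsSmoothManifold (JetFiberModel E F r) (JetGroup E F G r) ∧
      LieGroup 𝓘(ℝ, JetFiberModel E F r) ∞ (JetGroup E F G r) ∧
      Continuous (val : JetGroup E F G r → G) ∧
      ∀ χ ∈ IsManifold.maximalAtlas 𝓘(ℝ, F) ∞ G,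
        ∃ e ∈ IsManifold.maximalAtlas 𝓘(ℝ, JetFiberModel E F r) ∞ (JetGroup E F G r),
          e.source = val ⁻¹' χ.source ∧ ∀ γ, e γ = coord χ γ := by
  have := hG.t2Space
  have := hG.secondCountableTopology
  have hman := hG.isManifold
  obtain ⟨_, _, hX, hval, hchart⟩ := (isCoordinateSystem (E := E) (F := F) (G := G)
    (r := r)).exists_chartedSpace fun _ => ⟨1⟩
  have hXman := hX.isManifold
  refine ⟨inferInstance, inferInstance, hX, ?_, hval, fun χ hχ => hchart ⟨χ, hχ⟩⟩
  -- Division suffices: inversion is `1 / a`, and the product is `a / b⁻¹`.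
  have hdiv : ContMDiff (𝓘(ℝ, JetFiberModel E F r).prod 𝓘(ℝ, JetFiberModel E F r))
      𝓘(ℝ, JetFiberModel E F r) ∞
      fun z : JetGroup E F G r × JetGroup E F G r => z.1 / z.2 := by
    rintro ⟨γ, δ⟩
    obtain ⟨ea, ha, has, hac⟩ := hchart ⟨chartAt F γ.val, IsManifold.chart_mem_maximalAtlas _⟩
    obtain ⟨eb, hb, hbs, hbc⟩ := hchart ⟨chartAt F δ.val, IsManifold.chart_mem_maximalAtlas _⟩
    obtain ⟨ec, hc, hcs, hcc⟩ :=
      hchart ⟨chartAt F (γ.val / δ.val), IsManifold.chart_mem_maximalAtlas _⟩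
    have hγ : γ.val ∈ (chartAt F γ.val).source := mem_chart_source F _
    have hδ : δ.val ∈ (chartAt F δ.val).source := mem_chart_source F _
    have hγδ : γ.val / δ.val ∈ (chartAt F (γ.val / δ.val)).source := mem_chart_source F _
    have hB : ContMDiff (𝓘(ℝ, F).prod 𝓘(ℝ, F)) 𝓘(ℝ, F) ∞ fun z : G × G => z.1 / z.2 :=
      contMDiff_fst.div contMDiff_snd
    have ht := contDiffAt_coord_binop hB (IsManifold.chart_mem_maximalAtlas _)
      (IsManifold.chart_mem_maximalAtlas _) (IsManifold.chart_mem_maximalAtlas _) hγ hδ hγδ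
    have hga : γ ∈ ea.source := by rwa [has]
    have hgb : δ ∈ eb.source := by rwa [hbs]
    have hgc : γ / δ ∈ ec.source := by rw [hcs, Set.mem_preimage, val_div]; exact hγδ
    have hpair : ContMDiffAt (𝓘(ℝ, JetFiberModel E F r).prod 𝓘(ℝ, JetFiberModel E F r))
        𝓘(ℝ, JetFiberModel E F r × JetFiberModel E F r) ∞
        (fun z : JetGroup E F G r × JetGroup E F G r => (ea z.1, eb z.2)) (γ, δ) :=
      ((contMDiffAt_of_mem_maximalAtlas ha hga).comp (γ, δ) contMDiffAt_fst).prodMk_space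
        ((contMDiffAt_of_mem_maximalAtlas hb hgb).comp (γ, δ) contMDiffAt_snd)
    have hcomp := ContMDiffAt.comp (γ, δ) (f := fun z : JetGroup E F G r × JetGroup E F G r =>
      (ea z.1, eb z.2)) (by simpa only [hac, hbc] using ht.contMDiffAt) hpair
    have hev : ∀ᶠ z in 𝓝 (γ, δ), z.1 / z.2 ∈ ec.source := by
      -- Lying in the domain of `ec` is a condition on the value in `G` only, so continuity of `val`
      -- and of division in `G` is enough.
      have c3 : ContinuousAt (fun z : JetGroup E F G r × JetGroup E F G r => z.1.val / z.2.val)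
          (γ, δ) :=
        (hB.continuous.comp ((hval.comp continuous_fst).prodMk
          (hval.comp continuous_snd))).continuousAt
      filter_upwards [c3.eventually ((chartAt F (γ.val / δ.val)).open_source.mem_nhds hγδ)]
        with z h3
      rw [hcs, Set.mem_preimage, val_div]
      exact h3
    refine ContMDiffAt.of_maximalAtlas_comp hc hev (hcomp.congr_of_eventuallyEq ?_)
    filter_upwards [continuousAt_fst.eventually (ea.open_source.mem_nhds hga),
      continuousAt_snd.eventually (eb.open_source.mem_nhds hgb), hev] with z h1 h2 h3
    rw [has] at h1
    rw [hbs] at h2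
    rw [hcs] at h3
    simp only [hac, hbc, hcc, Function.comp_apply]
    exact coord_div (IsManifold.chart_mem_maximalAtlas _) (IsManifold.chart_mem_maximalAtlas _)
      (IsManifold.chart_mem_maximalAtlas _) h1 h2 h3
  have hinv : ContMDiff 𝓘(ℝ, JetFiberModel E F r) 𝓘(ℝ, JetFiberModel E F r) ∞
      fun a : JetGroup E F G r => a⁻¹ := by
    have := hdiv.comp ((contMDiff_const (c := (1 : JetGroup E F G r))).prodMk
      (contMDiff_id (M := JetGroup E F G r)))
    simpa only [Function.comp_def, id, one_div] using this
  refine { contMDiff_mul := ?_, contMDiff_inv := hinv }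
  have := hdiv.comp (contMDiff_fst.prodMk (hinv.comp contMDiff_snd))
  simpa only [Function.comp_def, div_inv_eq_mul] using this

end JetGroup

/-! ### Coordinates on jet bundles -/

section JetCoordinates

variable {M P EM EP F : Type*}
  [NormedAddCommGroup EM] [NormedSpace ℝ EM] [TopologicalSpace M] [ChartedSpace EM M]
  [NormedAddCommGroup EP] [NormedSpace ℝ EP] [TopologicalSpace P] [ChartedSpace EP P]
  [NormedAddCommGroup F] [NormedSpace ℝ F] {π : P → M} {r : ℕ}

namespace LocalSection

variable {m : M}

theorem eventually (σ : LocalSection EM EP π m) :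
    ∀ᶠ x in 𝓝 m, ContMDiffAt 𝓘(ℝ, EM) 𝓘(ℝ, EP) ∞ σ.toFun x ∧ π (σ.toFun x) = x := by
  obtain ⟨U, hU, hm, h1, h2⟩ := σ.exists_nhd
  filter_upwards [hU.mem_nhds hm] with x hx
  exact ⟨h1.contMDiffAt (hU.mem_nhds hx), h2 x hx⟩

theorem contMDiffAt (σ : LocalSection EM EP π m) :
    ContMDiffAt 𝓘(ℝ, EM) 𝓘(ℝ, EP) ∞ σ.toFun m := σ.eventually.self_of_nhds.1

theorem proj_apply (σ : LocalSection EM EP π m) : π (σ.toFun m) = m :=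
  σ.eventually.self_of_nhds.2

/-- A local section from a map that is eventually smooth and eventually a section. -/
def ofEventually (f : M → P)
    (hf : ∀ᶠ x in 𝓝 m, ContMDiffAt 𝓘(ℝ, EM) 𝓘(ℝ, EP) ∞ f x ∧ π (f x) = x) :
    LocalSection EM EP π m where
  toFun := f
  exists_nhd := by
    obtain ⟨U, h, hU, hm⟩ := eventually_nhds_iff.1 hf
    exact ⟨U, hU, hm, fun x hx => (h x hx).1.contMDiffWithinAt, fun x hx => (h x hx).2⟩

/-- The fiber component of a local section, read in an adapted chart. -/
def inChart (φ : OpenPartialHomeomorph M EM) (ψ : OpenPartialHomeomorph P (EM × F))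
    (σ : LocalSection EM EP π m) (y : EM) : F := (ψ (σ.toFun (φ.symm y))).2

theorem contMDiffAt_comp_symm {φ : OpenPartialHomeomorph M EM}
    (hφ : φ ∈ IsManifold.maximalAtlas 𝓘(ℝ, EM) ∞ M) (hm : m ∈ φ.source)
    (σ : LocalSection EM EP π m) :
    ContMDiffAt 𝓘(ℝ, EM) 𝓘(ℝ, EP) ∞ (fun y => σ.toFun (φ.symm y)) (φ m) := by
  refine ContMDiffAt.comp (φ m) ?_ (contMDiffAt_symm_of_mem_maximalAtlas hφ (φ.map_source hm))
  rw [φ.left_inv hm]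
  exact σ.contMDiffAt

end LocalSection

/-- `jetSetoid` reads each section in the chart at its own value; as the values agree, it is one and
the same chart. -/
theorem jetAt_eq_iff {m : M} {σ τ : LocalSection EM EP π m} :
    jetAt r σ = jetAt r τ ↔ SameJetInCharts EP r (fun y => σ.toFun ((chartAt EM m).symm y))
      (fun y => τ.toFun ((chartAt EM m).symm y)) (chartAt EM m m) := by
  have hm : (chartAt EM m).symm (chartAt EM m m) = m :=
    (chartAt EM m).left_inv (mem_chart_source EM m)
  have h1 : jetAt r σ = jetAt r τ ↔ (jetSetoid EM EP r π m).r σ τ := by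
    simp only [jetAt, Jet.mk.injEq, heq_eq_eq, true_and]
    exact Quotient.eq
  rw [h1]
  simp only [SameJetInCharts, hm]
  constructor
  · rintro ⟨h, h'⟩
    refine ⟨h, fun k hk => (h' k hk).trans ?_⟩
    rw [← h]
    rfl
  · rintro ⟨h, h'⟩
    refine ⟨h, fun k hk => (h' k hk).trans ?_⟩
    rw [h]
    rfl

theorem jetAt_congr {m : M} {σ τ : LocalSection EM EP π m} (h : σ.toFun =ᶠ[𝓝 m] τ.toFun) :
    jetAt r σ = jetAt r τ := by
  refine jetAt_eq_iff.2 (.of_eventuallyEq ?_)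
  have hc : Filter.Tendsto (chartAt EM m).symm (𝓝 (chartAt EM m m)) (𝓝 m) := by
    have := (chartAt EM m).continuousAt_symm (mem_chart_target EM m)
    rwa [ContinuousAt, (chartAt EM m).left_inv (mem_chart_source EM m)] at this
  exact hc.eventually h

theorem apply_eq_of_jetAt_eq {m : M} {σ τ : LocalSection EM EP π m} (h : jetAt r σ = jetAt r τ) :
    σ.toFun m = τ.toFun m := by
  have := (jetAt_eq_iff.1 h).1
  dsimp only at this
  rwa [(chartAt EM m).left_inv (mem_chart_source EM m)] at this

namespace Jet

/-- A local section representing a jet. -/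
def rep (j : Jet EM EP r π) : LocalSection EM EP π j.source := Quotient.out j.cls

theorem jetAt_rep (j : Jet EM EP r π) : jetAt r j.rep = j := by
  rw [jetAt, rep, Quotient.out_eq]

/-- The target of a jet. -/
def target (j : Jet EM EP r π) : P := j.rep.toFun j.source

theorem target_jetAt {m : M} (σ : LocalSection EM EP π m) : (jetAt r σ).target = σ.toFun m :=
  apply_eq_of_jetAt_eq (jetAt_rep (jetAt r σ))

theorem proj_target (j : Jet EM EP r π) : π j.target = j.source := j.rep.proj_apply

/-- The coordinates of a jet in an adapted chart. -/
def coord (φ : OpenPartialHomeomorph M EM) (ψ : OpenPartialHomeomorph P (EM × F))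
    (j : Jet EM EP r π) : EM × JetFiberModel EM F r :=
  (φ j.source, JetFiberModel.of r (j.rep.inChart φ ψ) (φ j.source))

end Jet

namespace IsAdaptedChart

variable {φ : OpenPartialHomeomorph M EM} {ψ : OpenPartialHomeomorph P (EM × F)}
  (h : IsAdaptedChart EM EP F π φ ψ)
include h

theorem mem_target {x : EM} {u : F} (hx : (x, u) ∈ ψ.target) : x ∈ φ.target := by
  have h1 := h.fst_eq _ (ψ.map_target hx)
  rw [ψ.right_inv hx] at h1
  rw [show x = _ from h1]
  exact φ.map_source (h.proj_mem _ (ψ.map_target hx))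

theorem proj_symm {x : EM} {u : F} (hx : (x, u) ∈ ψ.target) : π (ψ.symm (x, u)) = φ.symm x := by
  have h1 : x = φ (π (ψ.symm (x, u))) := by
    rw [← h.fst_eq _ (ψ.map_target hx), ψ.right_inv hx]
  have h2 := φ.left_inv (h.proj_mem _ (ψ.map_target hx))
  rw [← h1] at h2
  exact h2.symm

theorem contMDiffAt {p : P} (hp : p ∈ ψ.source) :
    ContMDiffAt 𝓘(ℝ, EP) 𝓘(ℝ, EM × F) ∞ ψ p :=
  h.contMDiffOn.contMDiffAt (ψ.open_source.mem_nhds hp)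

theorem contMDiffAt_snd {p : P} (hp : p ∈ ψ.source) :
    ContMDiffAt 𝓘(ℝ, EP) 𝓘(ℝ, F) ∞ (fun p => (ψ p).2) p :=
  contDiff_snd.contMDiff.contMDiffAt.comp p (h.contMDiffAt hp)

theorem contMDiffAt_symm {z : EM × F} (hz : z ∈ ψ.target) :
    ContMDiffAt 𝓘(ℝ, EM × F) 𝓘(ℝ, EP) ∞ ψ.symm z :=
  h.contMDiffOn_symm.contMDiffAt (ψ.open_target.mem_nhds hz)

variable {m : M}

theorem mem_base {σ : LocalSection EM EP π m} (hσ : σ.toFun m ∈ ψ.source) : m ∈ φ.source := by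
  have := h.proj_mem _ hσ
  rwa [σ.proj_apply] at this

theorem contDiffAt_inChart {σ : LocalSection EM EP π m} (hσ : σ.toFun m ∈ ψ.source) :
    ContDiffAt ℝ ∞ (σ.inChart φ ψ) (φ m) := by
  have hm := h.mem_base hσ
  refine ContMDiffAt.contDiffAt (ContMDiffAt.comp (φ m) (g := fun p => (ψ p).2)
    (h.contMDiffAt_snd ?_) (σ.contMDiffAt_comp_symm h.base_mem hm))
  rwa [φ.left_inv hm]

theorem apply_section {σ : LocalSection EM EP π m} (hσ : σ.toFun m ∈ ψ.source) :
    ∀ᶠ x in 𝓝 m, ψ.symm (φ x, σ.inChart φ ψ (φ x)) = σ.toFun x := by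
  filter_upwards [σ.eventually, φ.open_source.mem_nhds (h.mem_base hσ),
    σ.contMDiffAt.continuousAt.eventually (ψ.open_source.mem_nhds hσ)] with x h1 h2 h3
  have h4 : (φ x, σ.inChart φ ψ (φ x)) = ψ (σ.toFun x) := by
    refine Prod.ext ?_ ?_
    · rw [h.fst_eq _ h3, h1.2]
    · rw [LocalSection.inChart, φ.left_inv h2]
  rw [h4, ψ.left_inv h3]

/-- In an adapted chart a section has the form `y ↦ (y, u y)`; the first component is common to all
sections, so `u` decides. The two directions compose with `ψ` or `ψ.symm`, and with the change
between `φ` and the preferred chart of `M`. -/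
theorem jetAt_eq_iff [IsManifold 𝓘(ℝ, EM) ∞ M] [IsManifold 𝓘(ℝ, EP) ∞ P]
    {σ τ : LocalSection EM EP π m} (hσ : σ.toFun m ∈ ψ.source) (hτ : τ.toFun m ∈ ψ.source) :
    jetAt r σ = jetAt r τ ↔ SameJet r (σ.inChart φ ψ) (τ.inChart φ ψ) (φ m) := by
  have hm := h.mem_base hσ
  set χ := chartAt EM m with hχdef
  have hχ : χ ∈ IsManifold.maximalAtlas 𝓘(ℝ, EM) ∞ M := IsManifold.chart_mem_maximalAtlas m
  have hmχ : m ∈ χ.source := mem_chart_source EM m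
  rw [_root_.jetAt_eq_iff, ← hχdef]
  constructor
  · intro H
    have hB : ContDiffAt ℝ ∞ (fun y => χ (φ.symm y)) (φ m) := by
      refine ContMDiffAt.contDiffAt_maximalAtlas_comp hχ
        (contMDiffAt_symm_of_mem_maximalAtlas h.base_mem (φ.map_source hm)) ?_
      rwa [φ.left_inv hm]
    have hBm : χ (φ.symm (φ m)) = χ m := by rw [φ.left_inv hm]
    have key := SameJetInCharts.comp (A := fun p => (ψ p).2) (B := fun y => χ (φ.symm y))
      (y := φ m) (by rwa [hBm]) (by rw [hBm]; exact σ.contMDiffAt_comp_symm hχ hmχ)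
      (by rw [hBm]; exact τ.contMDiffAt_comp_symm hχ hmχ)
      (by rw [hBm, χ.left_inv hmχ]; exact h.contMDiffAt_snd hσ) hB
    have hev : ∀ᶠ y in 𝓝 (φ m), χ.symm (χ (φ.symm y)) = φ.symm y := by
      have := φ.continuousAt_symm (φ.map_source hm)
      filter_upwards [this.eventually (χ.open_source.mem_nhds (by rwa [φ.left_inv hm]))] with y hy
      exact χ.left_inv hy
    refine (SameJetInCharts.iff_sameJet.1 key).congr ?_ ?_
    · filter_upwards [hev] with y hy
      rw [hy, LocalSection.inChart]
    · filter_upwards [hev] with y hy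
      rw [hy, LocalSection.inChart]
  · intro H
    have cσ := h.contDiffAt_inChart hσ
    have cτ := h.contDiffAt_inChart hτ
    have hval : ∀ {ρ : LocalSection EM EP π m}, ρ.toFun m ∈ ψ.source →
        (φ m, ρ.inChart φ ψ (φ m)) ∈ ψ.target := by
      intro ρ hρ
      have : (φ m, ρ.inChart φ ψ (φ m)) = ψ (ρ.toFun m) := by
        refine Prod.ext ?_ ?_
        · rw [h.fst_eq _ hρ, ρ.proj_apply]
        · rw [LocalSection.inChart, φ.left_inv hm]
      rw [this]
      exact ψ.map_source hρ
    have H2 : SameJetInCharts EP r (fun y => ψ.symm (y, σ.inChart φ ψ y))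
        (fun y => ψ.symm (y, τ.inChart φ ψ y)) (φ m) :=
      (SameJet.rfl.prodMk H contDiffAt_id contDiffAt_id cσ cτ).inCharts (contDiffAt_id.prodMk cσ)
        (contDiffAt_id.prodMk cτ) (h.contMDiffAt_symm (hval hσ))
    have hBm : φ (χ.symm (χ m)) = φ m := by rw [χ.left_inv hmχ]
    have hB : ContDiffAt ℝ ∞ (fun y => φ (χ.symm y)) (χ m) := by
      refine ContMDiffAt.contDiffAt_maximalAtlas_comp h.base_mem
        (contMDiffAt_symm_of_mem_maximalAtlas hχ (χ.map_source hmχ)) ?_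
      rwa [χ.left_inv hmχ]
    have hc : ∀ {ρ : LocalSection EM EP π m}, ρ.toFun m ∈ ψ.source →
        ContMDiffAt 𝓘(ℝ, EM) 𝓘(ℝ, EP) ∞ (fun y => ψ.symm (y, ρ.inChart φ ψ y)) (φ m) :=
      fun hρ => (h.contMDiffAt_symm (hval hρ)).comp (φ m)
        (contDiffAt_id.prodMk (h.contDiffAt_inChart hρ)).contMDiffAt
    have key := SameJetInCharts.comp (A := fun p : P => p) (B := fun y => φ (χ.symm y))
      (y := χ m) (by rwa [hBm]) (by rw [hBm]; exact hc hσ) (by rw [hBm]; exact hc hτ)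
      contMDiffAt_id hB
    have hcχ : Filter.Tendsto χ.symm (𝓝 (χ m)) (𝓝 m) := by
      have := χ.continuousAt_symm (χ.map_source hmχ)
      rwa [ContinuousAt, χ.left_inv hmχ] at this
    refine key.congr ?_ ?_
    · filter_upwards [hcχ.eventually (h.apply_section hσ)] with y hy using hy.symm
    · filter_upwards [hcχ.eventually (h.apply_section hτ)] with y hy using hy.symm

theorem coord_jetAt [IsManifold 𝓘(ℝ, EM) ∞ M] [IsManifold 𝓘(ℝ, EP) ∞ P]
    {σ : LocalSection EM EP π m} (hσ : σ.toFun m ∈ ψ.source) :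
    (jetAt r σ).coord φ ψ = (φ m, JetFiberModel.of r (σ.inChart φ ψ) (φ m)) := by
  have hrep : (jetAt r σ).rep.toFun m ∈ ψ.source := by
    have := Jet.target_jetAt (r := r) σ
    rw [Jet.target] at this
    change (jetAt r σ).rep.toFun m = _ at this
    rwa [this]
  refine Prod.ext rfl ?_
  refine (JetFiberModel.of_eq_of_iff_sameJet (h.contDiffAt_inChart hrep)
    (h.contDiffAt_inChart hσ)).2 ((h.jetAt_eq_iff hrep hσ).1 ?_)
  exact Jet.jetAt_rep _

theorem coord_injOn [IsManifold 𝓘(ℝ, EM) ∞ M] [IsManifold 𝓘(ℝ, EP) ∞ P] :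
    Set.InjOn (Jet.coord (r := r) (π := π) (EP := EP) φ ψ) (Jet.target ⁻¹' ψ.source) := by
  intro j hj j' hj' e
  obtain ⟨m, σ, rfl⟩ : ∃ (m : M) (σ : LocalSection EM EP π m), j = jetAt r σ :=
    ⟨_, _, j.jetAt_rep.symm⟩
  obtain ⟨m', τ, rfl⟩ : ∃ (m : M) (σ : LocalSection EM EP π m), j' = jetAt r σ :=
    ⟨_, _, j'.jetAt_rep.symm⟩
  rw [Set.mem_preimage, Jet.target_jetAt] at hj hj'
  rw [h.coord_jetAt hj, h.coord_jetAt hj', Prod.mk.injEq] at e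
  obtain rfl := φ.injOn (h.mem_base hj) (h.mem_base hj') e.1
  exact (h.jetAt_eq_iff hj hj').2 ((JetFiberModel.of_eq_of_iff_sameJet (h.contDiffAt_inChart hj)
    (h.contDiffAt_inChart hj')).1 e.2)

theorem value_coord {j : Jet EM EP r π} (hj : j.target ∈ ψ.source) :
    ((j.coord φ ψ).1, (j.coord φ ψ).2.value) = ψ j.target := by
  have hm : j.source ∈ φ.source := h.mem_base (σ := j.rep) hj
  refine Prod.ext ?_ ?_
  · rw [h.fst_eq _ hj, j.proj_target]
    rfl
  · change JetFiberModel.value (JetFiberModel.of r (j.rep.inChart φ ψ) (φ j.source)) = _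
    rw [JetFiberModel.value_of (h.contDiffAt_inChart (σ := j.rep) hj), LocalSection.inChart,
      φ.left_inv hm]
    rfl

/-- The local section with given fiber component in an adapted chart. -/
def sectionOf {u : EM → F} (hu : ContDiff ℝ ∞ u) {x : EM} (hx : (x, u x) ∈ ψ.target) :
    LocalSection EM EP π (φ.symm x) :=
  .ofEventually (fun x => ψ.symm (φ x, u (φ x))) (by
    have hxt := h.mem_target hx
    have hc : Filter.Tendsto φ (𝓝 (φ.symm x)) (𝓝 x) := by
      have := φ.continuousAt (φ.map_target hxt)
      rwa [ContinuousAt, φ.right_inv hxt] at this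
    have hg : ContDiff ℝ ∞ fun y => (y, u y) := contDiff_id.prodMk hu
    filter_upwards [φ.open_source.mem_nhds (φ.map_target hxt), hc.eventually
      (hg.continuous.continuousAt.eventually (ψ.open_target.mem_nhds hx))] with x' h1 h2
    refine ⟨?_, by rw [h.proj_symm h2, φ.left_inv h1]⟩
    exact (h.contMDiffAt_symm h2).comp x' (hg.contMDiff.contMDiffAt.comp x'
      (contMDiffAt_of_mem_maximalAtlas h.base_mem h1)))

theorem sectionOf_apply {u : EM → F} (hu : ContDiff ℝ ∞ u) {x : EM} (hx : (x, u x) ∈ ψ.target) :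
    (h.sectionOf hu hx).toFun (φ.symm x) = ψ.symm (x, u x) := by
  change ψ.symm (φ (φ.symm x), u (φ (φ.symm x))) = _
  rw [φ.right_inv (h.mem_target hx)]

theorem coord_sectionOf [IsManifold 𝓘(ℝ, EM) ∞ M] [IsManifold 𝓘(ℝ, EP) ∞ P]
    {u : EM → F} (hu : ContDiff ℝ ∞ u) {x : EM} (hx : (x, u x) ∈ ψ.target) :
    (jetAt r (h.sectionOf hu hx)).coord φ ψ = (x, JetFiberModel.of r u x) := by
  have hxt := h.mem_target hx
  rw [h.coord_jetAt (by rw [h.sectionOf_apply]; exact ψ.map_target hx), φ.right_inv hxt]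
  congr 1
  refine JetFiberModel.of_congr ?_
  have hg : ContDiff ℝ ∞ fun y => (y, u y) := contDiff_id.prodMk hu
  filter_upwards [hg.continuous.continuousAt.eventually (ψ.open_target.mem_nhds hx)] with y hy
  change (ψ (ψ.symm (φ (φ.symm y), u (φ (φ.symm y))))).2 = _
  rw [φ.right_inv (h.mem_target hy), ψ.right_inv hy]

variable [FiniteDimensional ℝ F]

omit h in
theorem contDiff_taylor_sub (p : JetFiberModel EM F r) (x : EM) :
    ContDiff ℝ ∞ fun y => p.taylor (y - x) :=
  (p.contDiff_taylor_right.of_le le_top).comp (contDiff_id.sub contDiff_const)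

/-- The local section which is a Taylor polynomial in an adapted chart. -/
def taylorSection (z : EM × JetFiberModel EM F r) (hz : (z.1, z.2.value) ∈ ψ.target) :
    LocalSection EM EP π (φ.symm z.1) :=
  h.sectionOf (contDiff_taylor_sub z.2 z.1) (x := z.1)
    (by rwa [sub_self, JetFiberModel.taylor_zero])

theorem taylorSection_apply (z : EM × JetFiberModel EM F r) (hz : (z.1, z.2.value) ∈ ψ.target) :
    (h.taylorSection z hz).toFun (φ.symm z.1) = ψ.symm (z.1, z.2.value) := by
  rw [taylorSection, sectionOf_apply, sub_self, JetFiberModel.taylor_zero]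

theorem coord_taylorSection [IsManifold 𝓘(ℝ, EM) ∞ M] [IsManifold 𝓘(ℝ, EP) ∞ P]
    (z : EM × JetFiberModel EM F r) (hz : (z.1, z.2.value) ∈ ψ.target) :
    (jetAt r (h.taylorSection z hz)).coord φ ψ = z := by
  rw [taylorSection, coord_sectionOf, JetFiberModel.of_taylor_sub]

/-- Normal form of a jet in an adapted chart, used to compute changes of jet coordinates. -/
theorem eq_jetAt_taylorSection [IsManifold 𝓘(ℝ, EM) ∞ M] [IsManifold 𝓘(ℝ, EP) ∞ P]
    {j : Jet EM EP r π} (hj : j.target ∈ ψ.source) {z : EM × JetFiberModel EM F r}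
    (hz : j.coord φ ψ = z) :
    ∃ hz : (z.1, z.2.value) ∈ ψ.target, j = jetAt r (h.taylorSection z hz) := by
  subst hz
  have hz : ((j.coord φ ψ).1, (j.coord φ ψ).2.value) ∈ ψ.target := by
    rw [h.value_coord hj]
    exact ψ.map_source hj
  refine ⟨hz, h.coord_injOn hj ?_ (h.coord_taylorSection _ hz).symm⟩
  rw [Set.mem_preimage, Jet.target_jetAt, h.taylorSection_apply]
  exact ψ.map_target hz

end IsAdaptedChart

end JetCoordinates

/-! ### The smooth structure of the jet bundle -/

section JetManifold

variable {M P EM EP F : Type*}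
  [NormedAddCommGroup EM] [NormedSpace ℝ EM] [TopologicalSpace M] [ChartedSpace EM M]
  [NormedAddCommGroup EP] [NormedSpace ℝ EP] [TopologicalSpace P] [ChartedSpace EP P]
  [NormedAddCommGroup F] [NormedSpace ℝ F] {π : P → M}

namespace IsAdaptedChart

/-- Provides adapted charts with arbitrarily small domains: `proj_mem` asks only for an inclusion,
so `φ` need not shrink. -/
theorem restrOpen {φ : OpenPartialHomeomorph M EM} {ψ : OpenPartialHomeomorph P (EM × F)}
    (h : IsAdaptedChart EM EP F π φ ψ) {W : Set P} (hW : IsOpen W) :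
    IsAdaptedChart EM EP F π φ (ψ.restrOpen W hW) where
  base_mem := h.base_mem
  contMDiffOn := h.contMDiffOn.mono fun _ hp => hp.1
  contMDiffOn_symm := h.contMDiffOn_symm.mono fun _ hz => hz.1
  proj_mem p hp := h.proj_mem p hp.1
  fst_eq p hp := h.fst_eq p hp.1

variable [FiniteDimensional ℝ EM] [FiniteDimensional ℝ F] {r : ℕ}

/-- Changes of jet coordinates are smooth. -/
theorem contDiffAt_transition {φ φ' : OpenPartialHomeomorph M EM}
    {ψ ψ' : OpenPartialHomeomorph P (EM × F)} (h : IsAdaptedChart EM EP F π φ ψ)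
    (h' : IsAdaptedChart EM EP F π φ' ψ') {z : EM × JetFiberModel EM F r}
    (hz : (z.1, z.2.value) ∈ ψ.target) (hz' : ψ.symm (z.1, z.2.value) ∈ ψ'.source) :
    ContDiffAt ℝ ∞ (fun z : EM × JetFiberModel EM F r => (φ' (φ.symm z.1),
      JetFiberModel.of r (fun y => (ψ' (ψ.symm (φ (φ'.symm y),
        z.2.taylor (φ (φ'.symm y) - z.1)))).2) (φ' (φ.symm z.1)))) z := by
  have hx : z.1 ∈ φ.target := h.mem_target hz
  have hm' : φ.symm z.1 ∈ φ'.source := by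
    rw [← h.proj_symm hz]
    exact h'.proj_mem _ hz'
  have hc : ContDiffAt ℝ ∞ (fun z : EM × JetFiberModel EM F r => φ' (φ.symm z.1)) z :=
    ContDiffAt.comp z (g := fun x => φ' (φ.symm x))
      ((contMDiffAt_symm_of_mem_maximalAtlas h.base_mem hx).contDiffAt_maximalAtlas_comp
        h'.base_mem hm') contDiffAt_fst
  -- The parameter is the jet `z`. The Taylor polynomial is centred at `z.1`, and the point where
  -- derivatives are taken in the new chart moves with `z`.
  refine hc.prodMk (JetFiberModel.contDiffAt_of (c := fun z => φ' (φ.symm z.1))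
    (H := fun w : (EM × JetFiberModel EM F r) × EM =>
      (ψ' (ψ.symm (φ (φ'.symm w.2), w.1.2.taylor (φ (φ'.symm w.2) - w.1.1)))).2) ?_ hc)
  have hback : φ (φ'.symm (φ' (φ.symm z.1))) = z.1 := by
    rw [φ'.left_inv hm', φ.right_inv hx]
  have hb : ContDiffAt ℝ ∞ (fun y => φ (φ'.symm y)) (φ' (φ.symm z.1)) := by
    refine (contMDiffAt_symm_of_mem_maximalAtlas h'.base_mem
      (φ'.map_source hm')).contDiffAt_maximalAtlas_comp h.base_mem ?_
    rw [φ'.left_inv hm']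
    exact φ.map_target hx
  have hb' : ContDiffAt ℝ ∞ (fun w : (EM × JetFiberModel EM F r) × EM => φ (φ'.symm w.2))
      (z, φ' (φ.symm z.1)) :=
    ContDiffAt.comp (z, φ' (φ.symm z.1)) (g := fun y => φ (φ'.symm y)) hb contDiffAt_snd
  have ht : ContDiff ℝ ∞ (fun z : JetFiberModel EM F r × EM => z.1.taylor z.2) :=
    JetFiberModel.contDiff_taylor.of_le le_top
  have hpair : ContDiffAt ℝ ∞ (fun w : (EM × JetFiberModel EM F r) × EM =>
      (φ (φ'.symm w.2), w.1.2.taylor (φ (φ'.symm w.2) - w.1.1))) (z, φ' (φ.symm z.1)) := by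
    refine hb'.prodMk (ContDiffAt.comp (z, φ' (φ.symm z.1))
      (g := fun z : JetFiberModel EM F r × EM => z.1.taylor z.2)
      (f := fun w : (EM × JetFiberModel EM F r) × EM => (w.1.2, φ (φ'.symm w.2) - w.1.1))
      ht.contDiffAt ?_)
    exact (contDiff_snd.comp contDiff_fst).contDiffAt.prodMk
      (hb'.sub (contDiff_fst.comp contDiff_fst).contDiffAt)
  have hval : (φ (φ'.symm (φ' (φ.symm z.1))),
      z.2.taylor (φ (φ'.symm (φ' (φ.symm z.1))) - z.1)) = (z.1, z.2.value) := by
    rw [hback, sub_self, JetFiberModel.taylor_zero]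
  refine ContDiffAt.comp (z, φ' (φ.symm z.1)) (g := fun q : EM × F => (ψ' (ψ.symm q)).2) ?_ hpair
  refine ContMDiffAt.contDiffAt ?_
  dsimp only
  rw [hval]
  exact (h'.contMDiffAt_snd hz').comp (z.1, z.2.value) (h.contMDiffAt_symm hz)

end IsAdaptedChart

variable [FiniteDimensional ℝ EM] [FiniteDimensional ℝ F] [IsManifold 𝓘(ℝ, EM) ∞ M]
  [IsManifold 𝓘(ℝ, EP) ∞ P] {r : ℕ}

/-- Taylor sections give surjectivity, and on them the change of coordinates is the map of
`contDiffAt_transition`. -/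
theorem Jet.isCoordinateSystem
    (hex : ∀ p : P, ∃ (φ : OpenPartialHomeomorph M EM) (ψ : OpenPartialHomeomorph P (EM × F)),
      IsAdaptedChart EM EP F π φ ψ ∧ p ∈ ψ.source) :
    IsCoordinateSystem (Jet.target : Jet EM EP r π → P)
      (fun q : {q : OpenPartialHomeomorph M EM × OpenPartialHomeomorph P (EM × F) //
        IsAdaptedChart EM EP F π q.1 q.2} => q.1.2.source)
      (fun q => (fun z : EM × JetFiberModel EM F r => (z.1, z.2.value)) ⁻¹' q.1.2.target)
      (fun q => Jet.coord q.1.1 q.1.2) where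
  isOpen_base q := q.1.2.open_source
  isOpen_target q := q.1.2.open_target.preimage
    (continuous_fst.prodMk (JetFiberModel.value.continuous.comp continuous_snd))
  bijOn := by
    rintro ⟨⟨φ, ψ⟩, h⟩
    refine ⟨fun j hj => ?_, h.coord_injOn, fun z hz => ⟨jetAt r (h.taylorSection z hz), ?_,
      h.coord_taylorSection z hz⟩⟩
    · rw [Set.mem_preimage, h.value_coord hj]
      exact ψ.map_source hj
    · rw [Set.mem_preimage, Jet.target_jetAt, h.taylorSection_apply]
      exact ψ.map_target hz
  exists_subset j W hW hj := by
    obtain ⟨φ, ψ, h, hp⟩ := hex j.target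
    exact ⟨⟨(φ, ψ.restrOpen W hW), h.restrOpen hW⟩, ⟨hp, hj⟩, fun _ hx => hx.2⟩
  transition := by
    rintro ⟨⟨φ, ψ⟩, h⟩ ⟨⟨φ', ψ'⟩, h'⟩ j hj hj'
    dsimp only at hj hj' ⊢
    have hval := h.value_coord hj
    have hz : ((j.coord φ ψ).1, (j.coord φ ψ).2.value) ∈ ψ.target := by
      rw [hval]
      exact ψ.map_source hj
    have hz' : ψ.symm ((j.coord φ ψ).1, (j.coord φ ψ).2.value) ∈ ψ'.source := by
      rwa [hval, ψ.left_inv hj]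
    refine ⟨_, h.contDiffAt_transition h' hz hz', ?_⟩
    have hcont : Continuous fun z : EM × JetFiberModel EM F r => (z.1, z.2.value) :=
      continuous_fst.prodMk (JetFiberModel.value.continuous.comp continuous_snd)
    filter_upwards [hcont.continuousAt.eventually
      ((ψ.symm.isOpen_inter_preimage ψ'.open_source).mem_nhds ⟨hz, hz'⟩)] with z hz j' hj₁ hj₂
    obtain ⟨hzt, rfl⟩ := h.eq_jetAt_taylorSection hj₁ hj₂
    have hs : (h.taylorSection z hzt).toFun (φ.symm z.1) ∈ ψ'.source := by
      rw [h.taylorSection_apply]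
      exact hz.2
    refine ⟨by rwa [Jet.target_jetAt], ?_⟩
    rw [h'.coord_jetAt hs]
    rfl

/-- Jets of local sections form a manifold, for which the jet coordinates are smooth. -/
theorem Jet.exists_chartedSpace [T2Space P] [SecondCountableTopology P]
    (hex : ∀ p : P, ∃ (φ : OpenPartialHomeomorph M EM) (ψ : OpenPartialHomeomorph P (EM × F)),
      IsAdaptedChart EM EP F π φ ψ ∧ p ∈ ψ.source) (hne : Nonempty M → Nonempty P) (r : ℕ) :
    ∃ (_ : TopologicalSpace (Jet EM EP r π))
      (_ : ChartedSpace (EM × JetFiberModel EM F r) (Jet EM EP r π)),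
      IsSmoothManifold (EM × JetFiberModel EM F r) (Jet EM EP r π) ∧
      Continuous (Jet.target : Jet EM EP r π → P) ∧
      ∀ (φ : OpenPartialHomeomorph M EM) (ψ : OpenPartialHomeomorph P (EM × F)),
        IsAdaptedChart EM EP F π φ ψ →
        ∃ e ∈ IsManifold.maximalAtlas 𝓘(ℝ, EM × JetFiberModel EM F r) ∞ (Jet EM EP r π),
          e.source = Jet.target ⁻¹' ψ.source ∧ ∀ j, e j = j.coord φ ψ := by
  obtain ⟨_, _, h1, h2, h3⟩ := (Jet.isCoordinateSystem (r := r) hex).exists_chartedSpace fun q => by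
    -- Since `φ.symm` is a total function, the mere existence of `φ` yields a point of `M`, hence
    -- one of `P`; a section that is constant in an adapted chart gives a jet.
    obtain ⟨p⟩ := hne ⟨q.1.1.symm 0⟩
    obtain ⟨φ, ψ, h, hp⟩ := hex p
    exact ⟨jetAt r (h.sectionOf (u := fun _ => (ψ p).2) contDiff_const (ψ.map_source hp))⟩
  exact ⟨inferInstance, inferInstance, h1, h2, fun φ ψ h => h3 ⟨(φ, ψ), h⟩⟩

end JetManifold

/-! ### Adapted charts and fiber jets from local trivializations -/

section ProdChart

variable {M P EM F G : Type*} [NormedAddCommGroup EM] [TopologicalSpace M] [TopologicalSpace P]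
  [NormedAddCommGroup F] [TopologicalSpace G] {π : P → M}

/-- The chart of the total space given by a trivialization and charts of base and fiber. -/
def Bundle.Trivialization.prodChart (e : Bundle.Trivialization G π)
    (φ : OpenPartialHomeomorph M EM) (χ : OpenPartialHomeomorph G F) :
    OpenPartialHomeomorph P (EM × F) :=
  e.toOpenPartialHomeomorph.trans (φ.prod χ)

theorem Bundle.Trivialization.mem_prodChart_source {e : Bundle.Trivialization G π}
    {φ : OpenPartialHomeomorph M EM} {χ : OpenPartialHomeomorph G F} {p : P} :
    p ∈ (e.prodChart φ χ).source ↔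
      π p ∈ e.baseSet ∧ π p ∈ φ.source ∧ (e p).2 ∈ χ.source := by
  rw [prodChart, OpenPartialHomeomorph.trans_source, Set.mem_inter_iff, e.source_eq]
  refine and_congr_right fun hp => ?_
  have : e p = (π p, (e p).2) := Prod.ext (e.coe_fst' hp) rfl
  change e p ∈ φ.source ×ˢ χ.source ↔ _
  rw [this, Set.mem_prod]

end ProdChart

section Trivialization

variable {M P EM EP F G : Type*}
  [NormedAddCommGroup EM] [NormedSpace ℝ EM] [TopologicalSpace M] [ChartedSpace EM M]
  [NormedAddCommGroup EP] [NormedSpace ℝ EP] [TopologicalSpace P] [ChartedSpace EP P]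
  [NormedAddCommGroup F] [NormedSpace ℝ F] [TopologicalSpace G] [ChartedSpace F G]
  {π : P → M}

variable (EM EP F) in
/-- A local trivialization which is a diffeomorphism. -/
structure IsSmoothTrivialization (e : Bundle.Trivialization G π) : Prop where
  contMDiffOn : ContMDiffOn 𝓘(ℝ, EP) (𝓘(ℝ, EM).prod 𝓘(ℝ, F)) ∞ e e.source
  contMDiffOn_symm : ContMDiffOn (𝓘(ℝ, EM).prod 𝓘(ℝ, F)) 𝓘(ℝ, EP) ∞
    e.toOpenPartialHomeomorph.symm e.target

namespace IsSmoothTrivialization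

variable {e : Bundle.Trivialization G π} (he : IsSmoothTrivialization EM EP F e)
include he

theorem contMDiffAt {p : P} (hp : π p ∈ e.baseSet) :
    ContMDiffAt 𝓘(ℝ, EP) (𝓘(ℝ, EM).prod 𝓘(ℝ, F)) ∞ e p :=
  he.contMDiffOn.contMDiffAt (e.open_source.mem_nhds (e.mem_source.2 hp))

theorem contMDiffAt_symm {x : M} (hx : x ∈ e.baseSet) (g : G) :
    ContMDiffAt (𝓘(ℝ, EM).prod 𝓘(ℝ, F)) 𝓘(ℝ, EP) ∞ e.toOpenPartialHomeomorph.symm (x, g) :=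
  he.contMDiffOn_symm.contMDiffAt (e.open_target.mem_nhds (e.mem_target.2 hx))

theorem isAdaptedChart {φ : OpenPartialHomeomorph M EM}
    (hφ : φ ∈ IsManifold.maximalAtlas 𝓘(ℝ, EM) ∞ M) {χ : OpenPartialHomeomorph G F}
    (hχ : χ ∈ IsManifold.maximalAtlas 𝓘(ℝ, F) ∞ G) :
    IsAdaptedChart EM EP F π φ (e.prodChart φ χ) where
  base_mem := hφ
  contMDiffOn p hp := by
    obtain ⟨h1, h2, h3⟩ := Bundle.Trivialization.mem_prodChart_source.1 hp
    have hfst : (e p).1 ∈ φ.source := by rwa [e.coe_fst' h1]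
    have he' := he.contMDiffAt h1
    exact (((contMDiffAt_of_mem_maximalAtlas hφ hfst).comp p he'.fst).prodMk_space
      ((contMDiffAt_of_mem_maximalAtlas hχ h3).comp p he'.snd)).contMDiffWithinAt
  contMDiffOn_symm z hz := by
    have hz' : z ∈ φ.target ×ˢ χ.target ∧ (φ.symm z.1, χ.symm z.2) ∈ e.target := by
      rw [Bundle.Trivialization.prodChart, OpenPartialHomeomorph.trans_target] at hz
      exact hz
    obtain ⟨⟨h1, h2⟩, h3⟩ := hz'
    have h4 : ContMDiffAt 𝓘(ℝ, EM × F) 𝓘(ℝ, EM) ∞ (fun z : EM × F => φ.symm z.1) z :=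
      (contMDiffAt_symm_of_mem_maximalAtlas hφ h1).comp z contDiff_fst.contMDiff.contMDiffAt
    have h5 : ContMDiffAt 𝓘(ℝ, EM × F) 𝓘(ℝ, F) ∞ (fun z : EM × F => χ.symm z.2) z :=
      (contMDiffAt_symm_of_mem_maximalAtlas hχ h2).comp z contDiff_snd.contMDiff.contMDiffAt
    exact ((he.contMDiffAt_symm (e.mem_target.1 h3) _).comp z (h4.prodMk h5)).contMDiffWithinAt
  proj_mem p hp := (Bundle.Trivialization.mem_prodChart_source.1 hp).2.1
  fst_eq p hp := by
    change φ (e p).1 = _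
    rw [e.coe_fst' (Bundle.Trivialization.mem_prodChart_source.1 hp).1]

end IsSmoothTrivialization

end Trivialization

/-! ### Local trivializations of the jet bundle -/

theorem OpenPartialHomeomorph.tendsto_symm_add {M E : Type*} [NormedAddCommGroup E]
    [TopologicalSpace M] {φ : OpenPartialHomeomorph M E} {m : M} (hm : m ∈ φ.source) :
    Filter.Tendsto (fun y => φ.symm (φ m + y)) (𝓝 0) (𝓝 m) := by
  have h1 := φ.continuousAt_symm (φ.map_source hm)
  rw [ContinuousAt, φ.left_inv hm] at h1
  refine h1.comp ?_
  have : ContinuousAt (fun y => φ m + y) 0 := by fun_prop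
  simpa [ContinuousAt] using this

theorem Jet.target_mem_prodChart_source {M P EM EP F G : Type*}
    [NormedAddCommGroup EM] [NormedSpace ℝ EM] [TopologicalSpace M] [ChartedSpace EM M]
    [NormedAddCommGroup EP] [NormedSpace ℝ EP] [TopologicalSpace P] [ChartedSpace EP P]
    [NormedAddCommGroup F] [TopologicalSpace G] {π : P → M} {e : Bundle.Trivialization G π}
    {φ : OpenPartialHomeomorph M EM} {r : ℕ} {χ : OpenPartialHomeomorph G F} {j : Jet EM EP r π} :
    j.target ∈ (e.prodChart φ χ).source ↔
      j.source ∈ e.baseSet ∩ φ.source ∧ (e j.target).2 ∈ χ.source := by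
  rw [Bundle.Trivialization.mem_prodChart_source, j.proj_target, ← and_assoc, Set.mem_inter_iff]

section FiberJet

variable {M P EM EP F G : Type*}
  [NormedAddCommGroup EM] [NormedSpace ℝ EM] [TopologicalSpace M] [ChartedSpace EM M]
  [NormedAddCommGroup EP] [NormedSpace ℝ EP] [TopologicalSpace P] [ChartedSpace EP P]
  [NormedAddCommGroup F] [NormedSpace ℝ F] [TopologicalSpace G] [ChartedSpace F G] [Group G]
  [LieGroup 𝓘(ℝ, F) ∞ G] {π : P → M} {e : Bundle.Trivialization G π}
  {φ : OpenPartialHomeomorph M EM} {r : ℕ}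

namespace IsSmoothTrivialization

variable (he : IsSmoothTrivialization EM EP F e) (hφ : φ ∈ IsManifold.maximalAtlas 𝓘(ℝ, EM) ∞ M)
  {m : M}

/-- A local section read in a trivialization and a chart of the base, translated to the origin. -/
def fiberMap (hm : m ∈ e.baseSet ∩ φ.source) (σ : LocalSection EM EP π m) :
    smoothNearZero EM F G :=
  ⟨fun y => (e (σ.toFun (φ.symm (φ m + y)))).2, by
    have h1 : ∀ᶠ y in 𝓝 (0 : EM), φ m + y ∈ φ.target := by
      have : ContinuousAt (fun y => φ m + y) 0 := by fun_prop
      exact this.eventually (φ.open_target.mem_nhds (by simpa using φ.map_source hm.2))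
    filter_upwards [h1, (φ.tendsto_symm_add hm.2).eventually (σ.eventually.and
      (e.open_baseSet.mem_nhds hm.1))] with y hy ⟨⟨h2, h3⟩, h4⟩
    have h5 : ContMDiffAt 𝓘(ℝ, EM) 𝓘(ℝ, EM) ∞ (fun y => φ.symm (φ m + y)) y :=
      (contMDiffAt_symm_of_mem_maximalAtlas hφ hy).comp y
        (contDiff_const.add contDiff_id).contMDiff.contMDiffAt
    have h6 := he.contMDiffAt (p := σ.toFun (φ.symm (φ m + y))) (by rwa [h3])
    have h7 : ContMDiffAt 𝓘(ℝ, EM) 𝓘(ℝ, EP) ∞ (fun y => σ.toFun (φ.symm (φ m + y))) y :=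
      ContMDiffAt.comp y (g := σ.toFun) h2 h5
    exact ContMDiffAt.comp y (g := fun p => (e p).2) h6.snd h7⟩

theorem fiberMap_apply (hm : m ∈ e.baseSet ∩ φ.source) (σ : LocalSection EM EP π m) (y : EM) :
    (he.fiberMap hφ hm σ).1 y = (e (σ.toFun (φ.symm (φ m + y)))).2 := rfl

theorem fiberMap_apply_zero (hm : m ∈ e.baseSet ∩ φ.source) (σ : LocalSection EM EP π m) :
    (he.fiberMap hφ hm σ).1 0 = (e (σ.toFun m)).2 := by
  rw [fiberMap_apply, add_zero, φ.left_inv hm.2]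

/-- The translation by `φ m` moves the base point to `0` without changing the derivatives. -/
theorem coord_fiberMap {χ : OpenPartialHomeomorph G F}
    (hχ : χ ∈ IsManifold.maximalAtlas 𝓘(ℝ, F) ∞ G)
    (hm : m ∈ e.baseSet ∩ φ.source) {σ : LocalSection EM EP π m}
    (hσ : (e (σ.toFun m)).2 ∈ χ.source) :
    JetGroup.coord χ (JetGroup.mk (he.fiberMap hφ hm σ) : JetGroup EM F G r) =
      JetFiberModel.of r (σ.inChart φ (e.prodChart φ χ)) (φ m) := by
  rw [JetGroup.coord_mk hχ (by rwa [he.fiberMap_apply_zero])]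
  have := JetFiberModel.of_comp_add_left (r := r) (σ.inChart φ (e.prodChart φ χ)) (φ m) 0
  rw [add_zero] at this
  exact this

open Classical in
/-- The fiber component of a jet of local sections in the trivialization of the jet bundle. -/
def fiberJet (j : Jet EM EP r π) : JetGroup EM F G r :=
  -- The value `1` away from the trivialized region is arbitrary.
  if hj : j.source ∈ e.baseSet ∩ φ.source then JetGroup.mk (he.fiberMap hφ hj j.rep) else 1

theorem val_fiberJet {j : Jet EM EP r π} (hj : j.source ∈ e.baseSet ∩ φ.source) :
    (he.fiberJet hφ j).val = (e j.target).2 := by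
  rw [fiberJet, dif_pos hj, JetGroup.val_mk, he.fiberMap_apply_zero]
  rfl

/-- With the chart of `prodChart` on jets and that of `χ` on `JetGroup`, the trivialization of the
jet bundle is the identity in coordinates. -/
theorem coord_fiberJet {χ : OpenPartialHomeomorph G F}
    (hχ : χ ∈ IsManifold.maximalAtlas 𝓘(ℝ, F) ∞ G) {j : Jet EM EP r π}
    (hj : j.target ∈ (e.prodChart φ χ).source) :
    JetGroup.coord χ (he.fiberJet hφ j) = (j.coord φ (e.prodChart φ χ)).2 := by
  obtain ⟨h1, h2⟩ := Jet.target_mem_prodChart_source.1 hj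
  rw [fiberJet, dif_pos h1, he.coord_fiberMap hφ hχ h1 h2]
  rfl

section Bijective

variable [IsManifold 𝓘(ℝ, EM) ∞ M] [IsManifold 𝓘(ℝ, EP) ∞ P]

/-- Independence of the representative: both sides have the same coordinates in a chart around the
common value. -/
theorem fiberJet_jetAt (hm : m ∈ e.baseSet ∩ φ.source) (σ : LocalSection EM EP π m) :
    he.fiberJet hφ (jetAt r σ) = JetGroup.mk (he.fiberMap hφ hm σ) := by
  have : IsManifold 𝓘(ℝ, F) ∞ G := ContMDiffMul.toIsManifold
  let χ := chartAt F (e (σ.toFun m)).2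
  have hχ : χ ∈ IsManifold.maximalAtlas 𝓘(ℝ, F) ∞ G := IsManifold.chart_mem_maximalAtlas _
  have hσ : (e (σ.toFun m)).2 ∈ χ.source := mem_chart_source F _
  have ht : (jetAt r σ).target ∈ (e.prodChart φ χ).source :=
    Jet.target_mem_prodChart_source.2 ⟨hm, by rwa [Jet.target_jetAt]⟩
  refine JetGroup.coord_injOn hχ ?_ ?_ ?_
  · rwa [Set.mem_preimage, he.val_fiberJet hφ hm, Jet.target_jetAt]
  · rwa [Set.mem_preimage, JetGroup.val_mk, he.fiberMap_apply_zero]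
  · rw [he.coord_fiberJet hφ hχ ht, he.coord_fiberMap hφ hχ hm hσ,
      (he.isAdaptedChart hφ hχ).coord_jetAt (by rwa [← Jet.target_jetAt (r := r)])]

theorem eq_of_fiberJet_eq {j j' : Jet EM EP r π} (hj : j.source ∈ e.baseSet ∩ φ.source)
    (hs : j.source = j'.source) (h : he.fiberJet hφ j = he.fiberJet hφ j') : j = j' := by
  have : IsManifold 𝓘(ℝ, F) ∞ G := ContMDiffMul.toIsManifold
  have hj' : j'.source ∈ e.baseSet ∩ φ.source := hs ▸ hj
  have hv : (e j.target).2 = (e j'.target).2 := by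
    rw [← he.val_fiberJet hφ hj, h, he.val_fiberJet hφ hj']
  let χ := chartAt F (e j.target).2
  have hχ : χ ∈ IsManifold.maximalAtlas 𝓘(ℝ, F) ∞ G := IsManifold.chart_mem_maximalAtlas _
  have h1 : j.target ∈ (e.prodChart φ χ).source :=
    Jet.target_mem_prodChart_source.2 ⟨hj, mem_chart_source F _⟩
  have h2 : j'.target ∈ (e.prodChart φ χ).source :=
    Jet.target_mem_prodChart_source.2 ⟨hj', hv ▸ mem_chart_source F _⟩
  refine (he.isAdaptedChart hφ hχ).coord_injOn h1 h2 (Prod.ext (congrArg φ hs) ?_)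
  rw [← he.coord_fiberJet hφ hχ h1, ← he.coord_fiberJet hφ hχ h2, h]

/-- The local section with given fiber component. -/
def sectionOfFiberMap (hm : m ∈ e.baseSet ∩ φ.source) (a : smoothNearZero EM F G) :
    LocalSection EM EP π m :=
  .ofEventually (fun x => e.toOpenPartialHomeomorph.symm (x, a.1 (φ x - φ m))) (by
    have hc : Filter.Tendsto (fun x => φ x - φ m) (𝓝 m) (𝓝 0) := by
      simpa using (show Filter.Tendsto φ (𝓝 m) (𝓝 (φ m)) from φ.continuousAt hm.2).sub_const (φ m)
    have ha : ∀ᶠ y in 𝓝 0, ContMDiffAt 𝓘(ℝ, EM) 𝓘(ℝ, F) ∞ (a : EM → G) y := a.2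
    filter_upwards [hc.eventually ha, e.open_baseSet.mem_nhds hm.1, φ.open_source.mem_nhds hm.2]
      with x h1 h2 h3
    refine ⟨?_, e.proj_symm_apply' h2⟩
    have h4 : ContMDiffAt 𝓘(ℝ, EM) 𝓘(ℝ, EM) ∞ (fun x => φ x - φ m) x :=
      ContMDiffAt.comp x (g := fun y => y - φ m)
        (contDiff_id.sub contDiff_const).contMDiff.contMDiffAt
        (contMDiffAt_of_mem_maximalAtlas hφ h3)
    have h5 : ContMDiffAt 𝓘(ℝ, EM) 𝓘(ℝ, F) ∞ (fun x => (a : EM → G) (φ x - φ m)) x :=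
      ContMDiffAt.comp x (g := (a : EM → G)) h1 h4
    exact (he.contMDiffAt_symm h2 _).comp x (contMDiffAt_id.prodMk h5))

theorem fiberJet_sectionOfFiberMap (hm : m ∈ e.baseSet ∩ φ.source) (a : smoothNearZero EM F G) :
    he.fiberJet hφ (jetAt r (he.sectionOfFiberMap hφ hm a)) = JetGroup.mk a := by
  rw [he.fiberJet_jetAt hφ hm]
  refine JetGroup.mk_congr ?_
  have h1 : ∀ᶠ y in 𝓝 (0 : EM), φ m + y ∈ φ.target := by
    have : ContinuousAt (fun y => φ m + y) 0 := by fun_prop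
    exact this.eventually (φ.open_target.mem_nhds (by simpa using φ.map_source hm.2))
  filter_upwards [h1, (φ.tendsto_symm_add hm.2).eventually (e.open_baseSet.mem_nhds hm.1)]
    with y h1 h2
  rw [fiberMap_apply]
  change (e (e.toOpenPartialHomeomorph.symm (φ.symm (φ m + y),
    a.1 (φ (φ.symm (φ m + y)) - φ m)))).2 = _
  rw [e.apply_symm_apply' h2, φ.right_inv h1, add_sub_cancel_left]

/-- Injectivity is that of the jet coordinates; the section `x ↦ e⁻¹ (x, a (φ x - φ m))` realizes a
prescribed fiber component. -/
theorem bijOn_fiberJet : Set.BijOn (fun j : Jet EM EP r π => (j.source, he.fiberJet hφ j))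
    (Jet.source ⁻¹' (e.baseSet ∩ φ.source)) ((e.baseSet ∩ φ.source) ×ˢ Set.univ) := by
  refine ⟨fun j hj => ⟨hj, Set.mem_univ _⟩, fun j hj j' _ h => ?_, ?_⟩
  · rw [Prod.mk.injEq] at h
    exact he.eq_of_fiberJet_eq hφ hj h.1 h.2
  · rintro ⟨m, γ⟩ ⟨hm, -⟩
    refine ⟨jetAt r (he.sectionOfFiberMap hφ hm γ.rep), hm, Prod.ext rfl ?_⟩
    exact (he.fiberJet_sectionOfFiberMap hφ hm _).trans γ.mk_rep

end Bijective

section Smooth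

variable [TopologicalSpace (Jet EM EP r π)]
  [ChartedSpace (EM × JetFiberModel EM F r) (Jet EM EP r π)]
  [TopologicalSpace (JetGroup EM F G r)]
  [ChartedSpace (JetFiberModel EM F r) (JetGroup EM F G r)]
  (hval : Continuous (JetGroup.val : JetGroup EM F G r → G))
  (htarget : Continuous (Jet.target : Jet EM EP r π → P))
  (hgroup : ∀ χ ∈ IsManifold.maximalAtlas 𝓘(ℝ, F) ∞ G,
    ∃ E ∈ IsManifold.maximalAtlas 𝓘(ℝ, JetFiberModel EM F r) ∞ (JetGroup EM F G r),
      E.source = JetGroup.val ⁻¹' χ.source ∧ ∀ γ, E γ = JetGroup.coord χ γ)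
  (hjet : ∀ (φ : OpenPartialHomeomorph M EM) (ψ : OpenPartialHomeomorph P (EM × F)),
    IsAdaptedChart EM EP F π φ ψ →
    ∃ E ∈ IsManifold.maximalAtlas 𝓘(ℝ, EM × JetFiberModel EM F r) ∞ (Jet EM EP r π),
      E.source = Jet.target ⁻¹' ψ.source ∧ ∀ j, E j = j.coord φ ψ)

include hgroup hjet in
theorem contMDiffAt_fiberJet (j : Jet EM EP r π) (hj : j.source ∈ e.baseSet ∩ φ.source) :
    ContMDiffAt 𝓘(ℝ, EM × JetFiberModel EM F r) (𝓘(ℝ, EM).prod 𝓘(ℝ, JetFiberModel EM F r)) ∞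
      (fun j => (j.source, he.fiberJet hφ j)) j := by
  have : IsManifold 𝓘(ℝ, F) ∞ G := ContMDiffMul.toIsManifold
  let χ := chartAt F (e j.target).2
  have hχ : χ ∈ IsManifold.maximalAtlas 𝓘(ℝ, F) ∞ G := IsManifold.chart_mem_maximalAtlas _
  obtain ⟨EJ, hEJ, hEJs, hEJc⟩ := hjet φ _ (he.isAdaptedChart hφ hχ)
  obtain ⟨EG, hEG, hEGs, hEGc⟩ := hgroup χ hχ
  have hjE : j ∈ EJ.source := by
    rw [hEJs]
    exact Jet.target_mem_prodChart_source.2 ⟨hj, mem_chart_source F _⟩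
  have hnear : ∀ᶠ j' in 𝓝 j, j'.target ∈ (e.prodChart φ χ).source := by
    filter_upwards [EJ.open_source.mem_nhds hjE] with j' hj'
    rwa [hEJs] at hj'
  have hE := contMDiffAt_of_mem_maximalAtlas hEJ hjE
  refine ContMDiffAt.prodMk (ContMDiffAt.of_maximalAtlas_comp hφ ?_ ?_)
    (ContMDiffAt.of_maximalAtlas_comp hEG ?_ ?_)
  · filter_upwards [hnear] with j' hj' using (Jet.target_mem_prodChart_source.1 hj').1.2
  · refine (contDiff_fst.contMDiff.contMDiffAt.comp j hE).congr_of_eventuallyEq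
      (Filter.Eventually.of_forall fun j' => ?_)
    rw [Function.comp_apply, hEJc]
    rfl
  · filter_upwards [hnear] with j' hj'
    rw [hEGs, Set.mem_preimage, he.val_fiberJet hφ (Jet.target_mem_prodChart_source.1 hj').1]
    exact (Jet.target_mem_prodChart_source.1 hj').2
  · refine (contDiff_snd.contMDiff.contMDiffAt.comp j hE).congr_of_eventuallyEq ?_
    filter_upwards [hnear] with j' hj'
    rw [Function.comp_apply, hEJc, hEGc, he.coord_fiberJet hφ hχ hj']

-- The converse of the preceding smoothness, again because the coordinate expression is the
-- identity. That `S w` stays in the chart domain follows from continuity of `val`, as its fiber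
-- value is `w.2.val`.
include hval hgroup hjet in
theorem contMDiffAt_of_fiberJet {S : M × JetGroup EM F G r → Jet EM EP r π}
    (hS : ∀ z : M × JetGroup EM F G r, z.1 ∈ e.baseSet ∩ φ.source →
      (S z).source = z.1 ∧ he.fiberJet hφ (S z) = z.2)
    (z : M × JetGroup EM F G r) (hz : z.1 ∈ e.baseSet ∩ φ.source) :
    ContMDiffAt (𝓘(ℝ, EM).prod 𝓘(ℝ, JetFiberModel EM F r)) 𝓘(ℝ, EM × JetFiberModel EM F r) ∞
      S z := by
  have : IsManifold 𝓘(ℝ, F) ∞ G := ContMDiffMul.toIsManifold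
  let χ := chartAt F z.2.val
  have hχ : χ ∈ IsManifold.maximalAtlas 𝓘(ℝ, F) ∞ G := IsManifold.chart_mem_maximalAtlas _
  have hzχ : z.2.val ∈ χ.source := mem_chart_source F _
  obtain ⟨EJ, hEJ, hEJs, hEJc⟩ := hjet φ _ (he.isAdaptedChart hφ hχ)
  obtain ⟨EG, hEG, hEGs, hEGc⟩ := hgroup χ hχ
  have hnear : ∀ᶠ w in 𝓝 z, w.1 ∈ e.baseSet ∩ φ.source ∧
      (S w).target ∈ (e.prodChart φ χ).source := by
    have hU : IsOpen (e.baseSet ∩ φ.source) := e.open_baseSet.inter φ.open_source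
    filter_upwards [continuousAt_fst.eventually (hU.mem_nhds hz),
      (hval.comp continuous_snd).continuousAt.eventually (χ.open_source.mem_nhds hzχ)]
      with w h1 h2
    obtain ⟨h3, h4⟩ := hS w h1
    have h5 : (S w).source ∈ e.baseSet ∩ φ.source := h3.symm ▸ h1
    refine ⟨h1, Jet.target_mem_prodChart_source.2 ⟨h5, ?_⟩⟩
    rw [← he.val_fiberJet hφ h5, h4]
    exact h2
  refine ContMDiffAt.of_maximalAtlas_comp hEJ ?_ ?_
  · filter_upwards [hnear] with w hw
    rw [hEJs]
    exact hw.2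
  · have h1 : ContMDiffAt (𝓘(ℝ, EM).prod 𝓘(ℝ, JetFiberModel EM F r)) 𝓘(ℝ, EM) ∞
        (fun w : M × JetGroup EM F G r => φ w.1) z :=
      (contMDiffAt_of_mem_maximalAtlas hφ hz.2).comp z contMDiffAt_fst
    have h2 : ContMDiffAt (𝓘(ℝ, EM).prod 𝓘(ℝ, JetFiberModel EM F r))
        𝓘(ℝ, JetFiberModel EM F r) ∞ (fun w : M × JetGroup EM F G r => EG w.2) z :=
      (contMDiffAt_of_mem_maximalAtlas hEG (by rwa [hEGs])).comp z contMDiffAt_snd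
    refine (h1.prodMk_space h2).congr_of_eventuallyEq ?_
    filter_upwards [hnear] with w hw
    obtain ⟨h3, h4⟩ := hS w hw.1
    rw [hEJc, hEGc]
    refine Prod.ext (congrArg φ h3) ?_
    dsimp only
    rw [← he.coord_fiberJet hφ hχ hw.2, h4]

include hval htarget hgroup hjet in
/-- The local trivialization of the jet bundle given by a local trivialization of the bundle and a
chart of the base. -/
theorem exists_trivialization [IsManifold 𝓘(ℝ, EM) ∞ M] [IsManifold 𝓘(ℝ, EP) ∞ P]
    [Nonempty (Jet EM EP r π)] (hπ : Continuous π) :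
    ∃ T : Bundle.Trivialization (JetGroup EM F G r) (Jet.source : Jet EM EP r π → M),
      T.baseSet = e.baseSet ∩ φ.source ∧ (∀ j, (T j).2 = he.fiberJet hφ j) ∧
      IsSmoothTrivialization EM (EM × JetFiberModel EM F r) (JetFiberModel EM F r) T := by
  let T₀ := (he.bijOn_fiberJet hφ (r := r)).toPartialEquiv
  have hsymm : ∀ z : M × JetGroup EM F G r, z.1 ∈ e.baseSet ∩ φ.source →
      (T₀.symm z).source = z.1 ∧ he.fiberJet hφ (T₀.symm z) = z.2 := by
    intro z hz
    have := T₀.right_inv (x := z) ⟨hz, Set.mem_univ _⟩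
    exact Prod.ext_iff.1 this
  have hU : IsOpen (e.baseSet ∩ φ.source) := e.open_baseSet.inter φ.open_source
  have hs : Continuous (Jet.source : Jet EM EP r π → M) :=
    (hπ.comp htarget).congr fun j => j.proj_target
  have h1 : ContMDiffOn 𝓘(ℝ, EM × JetFiberModel EM F r)
      (𝓘(ℝ, EM).prod 𝓘(ℝ, JetFiberModel EM F r)) ∞ T₀ T₀.source := fun j hj =>
    (he.contMDiffAt_fiberJet hφ hgroup hjet j hj).contMDiffWithinAt
  have h2 : ContMDiffOn (𝓘(ℝ, EM).prod 𝓘(ℝ, JetFiberModel EM F r))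
      𝓘(ℝ, EM × JetFiberModel EM F r) ∞ T₀.symm T₀.target := fun z hz =>
    (he.contMDiffAt_of_fiberJet hφ hval hgroup hjet hsymm z hz.1).contMDiffWithinAt
  let T : Bundle.Trivialization (JetGroup EM F G r) (Jet.source : Jet EM EP r π → M) :=
    { toPartialEquiv := T₀
      open_source := hU.preimage hs
      open_target := hU.prod isOpen_univ
      continuousOn_toFun := h1.continuousOn
      continuousOn_invFun := h2.continuousOn
      baseSet := e.baseSet ∩ φ.source
      open_baseSet := hU
      source_eq := rfl
      target_eq := rfl
      proj_toFun := fun _ _ => rfl }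
  exact ⟨T, rfl, fun _ => rfl, ⟨h1, h2⟩⟩

end Smooth

end IsSmoothTrivialization

end FiberJet

/-! ### The group structure on jets -/

theorem Jet.exists_jetAt_eq {M P EM EP : Type*}
    [NormedAddCommGroup EM] [NormedSpace ℝ EM] [TopologicalSpace M] [ChartedSpace EM M]
    [NormedAddCommGroup EP] [NormedSpace ℝ EP] [TopologicalSpace P] [ChartedSpace EP P]
    {π : P → M} {r : ℕ} {p : Jet EM EP r π} {m : M} (hp : p.source = m) :
    ∃ σ : LocalSection EM EP π m, p = jetAt r σ := by
  subst hp
  exact ⟨_, p.jetAt_rep.symm⟩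

namespace IsLieGroupBundle

variable {M P EM EP F G : Type*}
  [NormedAddCommGroup EM] [NormedSpace ℝ EM] [TopologicalSpace M] [ChartedSpace EM M]
  [NormedAddCommGroup EP] [NormedSpace ℝ EP] [TopologicalSpace P] [ChartedSpace EP P]
  [NormedAddCommGroup F] [NormedSpace ℝ F] [TopologicalSpace G] [ChartedSpace F G] [Group G]
  {π : P → M} {mul : P → P → P} {one : M → P} {inv : P → P} {r : ℕ}

section Operations

variable (h : IsLieGroupBundle EM EP F G π mul one inv)

open Classical in
/-- The product of jets with the same source. -/
def jetMul (p q : Jet EM EP r π) : Jet EM EP r π :=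
  if hpq : q.source = p.source then
    jetAt r (h.mulSection p.rep (hpq ▸ q.rep : LocalSection EM EP π p.source))
  -- This choice keeps the source equal to that of `p`, so `source_jetMul` needs no condition.
  else p

/-- The jets of the unit section. -/
def jetOne (m : M) : Jet EM EP r π := jetAt r (h.oneSection m)

/-- The inverse of a jet. -/
def jetInv (p : Jet EM EP r π) : Jet EM EP r π := jetAt r (h.invSection p.rep)

end Operations

section FiberJet

variable [LieGroup 𝓘(ℝ, F) ∞ G] {e : Bundle.Trivialization G π}
  (he : IsSmoothTrivialization EM EP F e) {φ : OpenPartialHomeomorph M EM}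
  (hφ : φ ∈ IsManifold.maximalAtlas 𝓘(ℝ, EM) ∞ M) {m : M} (hm : m ∈ e.baseSet ∩ φ.source)
  (h : IsLieGroupBundle EM EP F G π mul one inv)
include h

/-- Multiplicativity of `e` on all fibers near `m` makes the two maps `EM → G` equal on a
neighbourhood of `0`, hence equal as jets. -/
theorem mk_fiberMap_mulSection
    (hmul : ∀ p q, π p ∈ e.baseSet → π p = π q → (e (mul p q)).2 = (e p).2 * (e q).2)
    (σ τ : LocalSection EM EP π m) :
    (JetGroup.mk (he.fiberMap hφ hm (h.mulSection σ τ)) : JetGroup EM F G r) =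
      JetGroup.mk (he.fiberMap hφ hm σ) * JetGroup.mk (he.fiberMap hφ hm τ) := by
  rw [← map_mul]
  refine JetGroup.mk_congr ?_
  filter_upwards [(φ.tendsto_symm_add hm.2).eventually (σ.eventually.and
    (τ.eventually.and (e.open_baseSet.mem_nhds hm.1)))] with y ⟨h1, h2, h3⟩
  exact hmul _ _ (by rwa [h1.2]) (by rw [h1.2, h2.2])

theorem mk_fiberMap_oneSection (hone : ∀ x ∈ e.baseSet, (e (one x)).2 = 1) :
    (JetGroup.mk (he.fiberMap hφ hm (h.oneSection m)) : JetGroup EM F G r) = 1 := by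
  rw [← map_one JetGroup.mk]
  refine JetGroup.mk_congr ?_
  filter_upwards [(φ.tendsto_symm_add hm.2).eventually (e.open_baseSet.mem_nhds hm.1)] with y hy
  exact hone _ hy

theorem mk_fiberMap_invSection (hinv : ∀ p, π p ∈ e.baseSet → (e (inv p)).2 = (e p).2⁻¹)
    (σ : LocalSection EM EP π m) :
    (JetGroup.mk (he.fiberMap hφ hm (h.invSection σ)) : JetGroup EM F G r) =
      (JetGroup.mk (he.fiberMap hφ hm σ))⁻¹ := by
  rw [← map_inv]
  refine JetGroup.mk_congr ?_
  filter_upwards [(φ.tendsto_symm_add hm.2).eventually (σ.eventually.and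
    (e.open_baseSet.mem_nhds hm.1))] with y ⟨h1, h2⟩
  exact hinv _ (by rwa [h1.2])

end FiberJet

section Formulas

variable (h : IsLieGroupBundle EM EP F G π mul one inv)
include h

/-- The product of `P` is smooth only on the fiber product, so no chain rule on `P × P` is used; a
trivialization carries the claim to `JetGroup`, where multiplication is already defined on jets. -/
theorem jetAt_mulSection_congr {m : M} {σ σ' τ τ' : LocalSection EM EP π m}
    (hσ : jetAt r σ = jetAt r σ') (hτ : jetAt r τ = jetAt r τ') :
    jetAt r (h.mulSection σ τ) = jetAt r (h.mulSection σ' τ') := by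
  have := h.lieGroup
  have := h.base.isManifold
  have := h.total.isManifold
  obtain ⟨e, hm, h1, h2, hmul, -, -⟩ := h.exists_trivialization m
  have he : IsSmoothTrivialization EM EP F e := ⟨h1, h2⟩
  have hφ := IsManifold.chart_mem_maximalAtlas (I := 𝓘(ℝ, EM)) (n := ∞) m
  have hm' : m ∈ e.baseSet ∩ (chartAt EM m).source := ⟨hm, mem_chart_source EM m⟩
  refine he.eq_of_fiberJet_eq hφ hm' rfl ?_
  rw [he.fiberJet_jetAt hφ hm', he.fiberJet_jetAt hφ hm', h.mk_fiberMap_mulSection he hφ hm' hmul,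
    h.mk_fiberMap_mulSection he hφ hm' hmul, ← he.fiberJet_jetAt hφ hm',
    ← he.fiberJet_jetAt hφ hm', ← he.fiberJet_jetAt hφ hm', ← he.fiberJet_jetAt hφ hm', hσ, hτ]

theorem jetAt_invSection_congr {m : M} {σ τ : LocalSection EM EP π m}
    (hσ : jetAt r σ = jetAt r τ) : jetAt r (h.invSection σ) = jetAt r (h.invSection τ) := by
  have := h.lieGroup
  have := h.base.isManifold
  have := h.total.isManifold
  obtain ⟨e, hm, h1, h2, -, -, hinv⟩ := h.exists_trivialization m
  have he : IsSmoothTrivialization EM EP F e := ⟨h1, h2⟩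
  have hφ := IsManifold.chart_mem_maximalAtlas (I := 𝓘(ℝ, EM)) (n := ∞) m
  have hm' : m ∈ e.baseSet ∩ (chartAt EM m).source := ⟨hm, mem_chart_source EM m⟩
  refine he.eq_of_fiberJet_eq hφ hm' rfl ?_
  rw [he.fiberJet_jetAt hφ hm', he.fiberJet_jetAt hφ hm', h.mk_fiberMap_invSection he hφ hm' hinv,
    h.mk_fiberMap_invSection he hφ hm' hinv, ← he.fiberJet_jetAt hφ hm',
    ← he.fiberJet_jetAt hφ hm', hσ]

theorem jetMul_jetAt {m : M} (σ τ : LocalSection EM EP π m) :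
    h.jetMul (jetAt r σ) (jetAt r τ) = jetAt r (h.mulSection σ τ) := by
  rw [jetMul, dif_pos (show (jetAt r τ).source = (jetAt r σ).source from rfl)]
  exact h.jetAt_mulSection_congr (Jet.jetAt_rep (jetAt r σ)) (Jet.jetAt_rep (jetAt r τ))

theorem jetInv_jetAt {m : M} (σ : LocalSection EM EP π m) :
    h.jetInv (jetAt r σ) = jetAt r (h.invSection σ) :=
  h.jetAt_invSection_congr (Jet.jetAt_rep (jetAt r σ))

theorem source_jetMul (p q : Jet EM EP r π) : (h.jetMul p q).source = p.source := by
  rw [jetMul]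
  split_ifs <;> rfl

theorem exists_isAdaptedChart (p : P) :
    ∃ (φ : OpenPartialHomeomorph M EM) (ψ : OpenPartialHomeomorph P (EM × F)),
      IsAdaptedChart EM EP F π φ ψ ∧ p ∈ ψ.source := by
  have := h.fiber.isManifold
  have := h.base.isManifold
  obtain ⟨e, hm, h1, h2, -⟩ := h.exists_trivialization (π p)
  have he : IsSmoothTrivialization EM EP F e := ⟨h1, h2⟩
  exact ⟨_, _, he.isAdaptedChart (IsManifold.chart_mem_maximalAtlas (π p))
    (IsManifold.chart_mem_maximalAtlas (e p).2), Bundle.Trivialization.mem_prodChart_source.2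
      ⟨hm, mem_chart_source EM _, mem_chart_source F _⟩⟩

end Formulas

end IsLieGroupBundle

namespace IsLieGroupBundle

section JetBundle

variable {M P EM EP F G : Type*}
  [NormedAddCommGroup EM] [NormedSpace ℝ EM] [TopologicalSpace M] [ChartedSpace EM M]
  [NormedAddCommGroup EP] [NormedSpace ℝ EP] [TopologicalSpace P] [ChartedSpace EP P]
  [NormedAddCommGroup F] [NormedSpace ℝ F] [TopologicalSpace G] [ChartedSpace F G] [Group G]
  {π : P → M} {mul : P → P → P} {one : M → P} {inv : P → P} {r : ℕ}
  [LieGroup 𝓘(ℝ, F) ∞ G]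
  [TopologicalSpace (Jet EM EP r π)]
  [ChartedSpace (EM × JetFiberModel EM F r) (Jet EM EP r π)]
  [TopologicalSpace (JetGroup EM F G r)]
  [ChartedSpace (JetFiberModel EM F r) (JetGroup EM F G r)]

/-- If the jet bundle of a Lie group bundle has local trivializations by fiber jets, it is a Lie
group bundle. -/
theorem jetBundle (h : IsLieGroupBundle EM EP F G π mul one inv)
    (hjet : IsSmoothManifold (EM × JetFiberModel EM F r) (Jet EM EP r π))
    (hfiber : IsSmoothManifold (JetFiberModel EM F r) (JetGroup EM F G r))
    (hgroup : LieGroup 𝓘(ℝ, JetFiberModel EM F r) ∞ (JetGroup EM F G r))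
    (htriv : ∀ (m : M) (e : Bundle.Trivialization G π) (he : IsSmoothTrivialization EM EP F e)
      (φ : OpenPartialHomeomorph M EM) (hφ : φ ∈ IsManifold.maximalAtlas 𝓘(ℝ, EM) ∞ M),
      m ∈ e.baseSet ∩ φ.source →
      ∃ T : Bundle.Trivialization (JetGroup EM F G r) (Jet.source : Jet EM EP r π → M),
        T.baseSet = e.baseSet ∩ φ.source ∧ (∀ j, (T j).2 = he.fiberJet hφ j) ∧
        IsSmoothTrivialization EM (EM × JetFiberModel EM F r) (JetFiberModel EM F r) T) :
    IsLieGroupBundle EM (EM × JetFiberModel EM F r) (JetFiberModel EM F r) (JetGroup EM F G r)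
      (Jet.source : Jet EM EP r π → M) h.jetMul h.jetOne h.jetInv := by
  have := h.base.isManifold
  have := h.total.isManifold
  have hT : ∀ m : M, ∃ T : Bundle.Trivialization (JetGroup EM F G r)
      (Jet.source : Jet EM EP r π → M), m ∈ T.baseSet ∧
      IsSmoothTrivialization EM (EM × JetFiberModel EM F r) (JetFiberModel EM F r) T ∧
      (∀ p q, p.source ∈ T.baseSet → p.source = q.source →
        (T (h.jetMul p q)).2 = (T p).2 * (T q).2) ∧
      (∀ x ∈ T.baseSet, (T (h.jetOne x)).2 = 1) ∧
      (∀ p, p.source ∈ T.baseSet → (T (h.jetInv p)).2 = (T p).2⁻¹) := by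
    intro m
    obtain ⟨e, hm, h1, h2, hmul, hone, hinv⟩ := h.exists_trivialization m
    have he : IsSmoothTrivialization EM EP F e := ⟨h1, h2⟩
    have hφ := IsManifold.chart_mem_maximalAtlas (I := 𝓘(ℝ, EM)) (n := ∞) m
    have hm' : m ∈ e.baseSet ∩ (chartAt EM m).source := ⟨hm, mem_chart_source EM m⟩
    obtain ⟨T, hTb, hTj, hTs⟩ := htriv m e he _ hφ hm'
    refine ⟨T, hTb ▸ hm', hTs, fun p q hp hpq => ?_, fun x hx => ?_, fun p hp => ?_⟩
    · rw [hTb] at hp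
      obtain ⟨σ, hσ⟩ := p.exists_jetAt_eq rfl
      obtain ⟨τ, rfl⟩ := q.exists_jetAt_eq hpq.symm
      -- The type of `σ` mentions `p.source`; only once this is a free variable can `p` be
      -- substituted.
      generalize p.source = x at *
      subst hσ
      rw [h.jetMul_jetAt, hTj, hTj, hTj, he.fiberJet_jetAt hφ hp, he.fiberJet_jetAt hφ hp,
        he.fiberJet_jetAt hφ hp, h.mk_fiberMap_mulSection he hφ hp hmul]
    · rw [hTb] at hx
      rw [jetOne, hTj, he.fiberJet_jetAt hφ hx, h.mk_fiberMap_oneSection he hφ hx hone]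
    · rw [hTb] at hp
      obtain ⟨σ, hσ⟩ := p.exists_jetAt_eq rfl
      generalize p.source = x at *
      subst hσ
      rw [h.jetInv_jetAt, hTj, hTj, he.fiberJet_jetAt hφ hp, he.fiberJet_jetAt hφ hp,
        h.mk_fiberMap_invSection he hφ hp hinv]
  have hsource : ContMDiff 𝓘(ℝ, EM × JetFiberModel EM F r) 𝓘(ℝ, EM) ∞
      (Jet.source : Jet EM EP r π → M) := by
    intro j
    obtain ⟨T, hm, hTs, -⟩ := hT j.source
    refine (hTs.contMDiffAt hm).fst.congr_of_eventuallyEq ?_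
    filter_upwards [T.open_source.mem_nhds (T.mem_source.2 hm)] with j' hj'
    exact (T.coe_fst hj').symm
  have hback : ∀ {T : Bundle.Trivialization (JetGroup EM F G r) (Jet.source : Jet EM EP r π → M)}
      {j : Jet EM EP r π}, j.source ∈ T.baseSet →
      j = T.toOpenPartialHomeomorph.symm (j.source, (T j).2) := by
    intro T j hj
    exact (T.symm_apply_mk_proj (T.mem_source.2 hj)).symm
  have hinvsource : ∀ p : Jet EM EP r π, (h.jetInv p).source = p.source := fun _ => rfl
  refine
    { base := h.base
      total := hjet
      fiber := hfiber
      lieGroup := hgroup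
      contMDiff_proj := hsource
      proj_mul := fun p q _ => h.source_jetMul p q
      contMDiffOn_mul := ?_
      proj_one := fun _ => rfl
      contMDiff_one := ?_
      proj_inv := hinvsource
      contMDiff_inv := ?_
      mul_assoc := ?_
      one_mul := ?_
      mul_one := ?_
      inv_mul := ?_
      mul_inv := ?_
      exists_trivialization := fun m => ?_ }
  · rintro ⟨p, q⟩ hpq
    obtain ⟨T, hp, hTs, hmul, -, -⟩ := hT p.source
    have hq : q.source ∈ T.baseSet := (show p.source = q.source from hpq) ▸ hp
    have h1 : ContMDiffAt (𝓘(ℝ, EM × JetFiberModel EM F r).prod 𝓘(ℝ, EM × JetFiberModel EM F r))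
        (𝓘(ℝ, EM).prod 𝓘(ℝ, JetFiberModel EM F r)) ∞
        (fun z : Jet EM EP r π × Jet EM EP r π => (z.1.source, (T z.1).2 * (T z.2).2)) (p, q) :=
      ((hsource.comp contMDiff_fst).contMDiffAt).prodMk
        (((hTs.contMDiffAt hp).snd.comp (p, q) contMDiffAt_fst).mul
          ((hTs.contMDiffAt hq).snd.comp (p, q) contMDiffAt_snd))
    have h2 := (hTs.contMDiffAt_symm hp ((T p).2 * (T q).2)).comp (p, q) h1
    -- The formula in the trivialization is smooth on an open set, but agrees with `jetMul` only on
    -- the fiber product; hence the comparison takes place within that set.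
    have hev : ∀ z ∈ {z : Jet EM EP r π × Jet EM EP r π | z.1.source = z.2.source},
        z.1.source ∈ T.baseSet → h.jetMul z.1 z.2 =
          T.toOpenPartialHomeomorph.symm (z.1.source, (T z.1).2 * (T z.2).2) := by
      intro z hz hzT
      rw [← hmul _ _ hzT hz, ← h.source_jetMul z.1 z.2]
      exact hback (by rwa [h.source_jetMul])
    refine h2.contMDiffWithinAt.congr_of_eventuallyEq ?_ (hev _ hpq hp)
    filter_upwards [self_mem_nhdsWithin, nhdsWithin_le_nhds
      ((hsource.continuous.comp continuous_fst).continuousAt.eventually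
        (T.open_baseSet.mem_nhds hp))] with z hz hzT using hev z hz hzT
  · intro m
    obtain ⟨T, hm, hTs, -, hone, -⟩ := hT m
    refine ((hTs.contMDiffAt_symm hm 1).comp m
      (contMDiffAt_id.prodMk contMDiffAt_const)).congr_of_eventuallyEq ?_
    filter_upwards [T.open_baseSet.mem_nhds hm] with x hx
    rw [Function.comp_apply, ← hone x hx]
    exact hback (j := h.jetOne x) hx
  · intro p
    obtain ⟨T, hp, hTs, -, -, hinv⟩ := hT p.source
    refine ((hTs.contMDiffAt_symm hp (T p).2⁻¹).comp p
      (hsource.contMDiffAt.prodMk (hTs.contMDiffAt hp).snd.inv)).congr_of_eventuallyEq ?_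
    filter_upwards [hsource.continuous.continuousAt.eventually (T.open_baseSet.mem_nhds hp)]
      with q hq
    rw [Function.comp_apply, ← hinv q hq]
    exact hback (j := h.jetInv q) hq
  · intro p q s hpq hqs
    obtain ⟨m, hm⟩ : ∃ m, s.source = m := ⟨_, rfl⟩
    obtain ⟨σ, rfl⟩ := p.exists_jetAt_eq (hpq.trans (hqs.trans hm))
    obtain ⟨τ, rfl⟩ := q.exists_jetAt_eq (hqs.trans hm)
    obtain ⟨ρ, rfl⟩ := s.exists_jetAt_eq hm
    rw [h.jetMul_jetAt, h.jetMul_jetAt, h.jetMul_jetAt, h.jetMul_jetAt]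
    -- The identity holds pointwise for the sections near `m`, so the jets agree; the other group
    -- axioms are treated in the same way.
    refine jetAt_congr ?_
    filter_upwards [σ.eventually, τ.eventually, ρ.eventually] with x h1 h2 h3
    exact h.mul_assoc _ _ _ (by rw [h1.2, h2.2]) (by rw [h2.2, h3.2])
  · intro p
    obtain ⟨m, σ, rfl⟩ : ∃ (m : M) (σ : LocalSection EM EP π m), p = jetAt r σ :=
      ⟨_, p.exists_jetAt_eq rfl⟩
    refine (h.jetMul_jetAt _ _).trans (jetAt_congr ?_)
    filter_upwards [σ.eventually] with x hx
    have := h.one_mul (σ.toFun x)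
    rwa [hx.2] at this
  · intro p
    obtain ⟨m, σ, rfl⟩ : ∃ (m : M) (σ : LocalSection EM EP π m), p = jetAt r σ :=
      ⟨_, p.exists_jetAt_eq rfl⟩
    refine (h.jetMul_jetAt _ _).trans (jetAt_congr ?_)
    filter_upwards [σ.eventually] with x hx
    have := h.mul_one (σ.toFun x)
    rwa [hx.2] at this
  · intro p
    obtain ⟨m, σ, rfl⟩ : ∃ (m : M) (σ : LocalSection EM EP π m), p = jetAt r σ :=
      ⟨_, p.exists_jetAt_eq rfl⟩
    rw [h.jetInv_jetAt, h.jetMul_jetAt]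
    refine jetAt_congr ?_
    filter_upwards [σ.eventually] with x hx
    have := h.inv_mul (σ.toFun x)
    rwa [hx.2] at this
  · intro p
    obtain ⟨m, σ, rfl⟩ : ∃ (m : M) (σ : LocalSection EM EP π m), p = jetAt r σ :=
      ⟨_, p.exists_jetAt_eq rfl⟩
    rw [h.jetInv_jetAt, h.jetMul_jetAt]
    refine jetAt_congr ?_
    filter_upwards [σ.eventually] with x hx
    have := h.mul_inv (σ.toFun x)
    rwa [hx.2] at this
  · obtain ⟨T, hm, hTs, h1, h2, h3⟩ := hT m
    exact ⟨T, hm, hTs.contMDiffOn, hTs.contMDiffOn_symm, h1, h2, h3⟩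

end JetBundle

end IsLieGroupBundle

end

theorem mainTheorem1
    {EM F : Type uE} {G : Type uG} {M : Type uM} {P : Type uP} {EP : Type uT}
    [NormedAddCommGroup EM] [NormedSpace ℝ EM] [TopologicalSpace M] [ChartedSpace EM M]
    [NormedAddCommGroup EP] [NormedSpace ℝ EP] [TopologicalSpace P] [ChartedSpace EP P]
    [NormedAddCommGroup F] [NormedSpace ℝ F] [TopologicalSpace G] [ChartedSpace F G] [Group G]
    {π : P → M} {mul : P → P → P} {one : M → P} {inv : P → P}
    (h : IsLieGroupBundle EM EP F G π mul one inv) (r : ℕ) (hr : 1 ≤ r) :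
    ∃ (_ : TopologicalSpace (Jet EM EP r π))
      (_ : ChartedSpace (EM × JetFiberModel EM F r) (Jet EM EP r π)),
      IsJetSmoothStructure EM EP F r π ∧
      ∃ (Gr : Type (max uE uG)) (_ : TopologicalSpace Gr)
        (_ : ChartedSpace (JetFiberModel EM F r) Gr) (_ : Group Gr)
        (mulJ : Jet EM EP r π → Jet EM EP r π → Jet EM EP r π)
        (oneJ : M → Jet EM EP r π) (invJ : Jet EM EP r π → Jet EM EP r π),
        IsLieGroupBundle EM (EM × JetFiberModel EM F r) (JetFiberModel EM F r) Gr
          (Jet.source : Jet EM EP r π → M) mulJ oneJ invJ ∧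
        (∀ (m : M) (σ τ : LocalSection EM EP π m),
          mulJ (jetAt r σ) (jetAt r τ) = jetAt r (h.mulSection σ τ)) ∧
        (∀ m : M, oneJ m = jetAt r (h.oneSection m)) ∧
        (∀ (m : M) (σ : LocalSection EM EP π m),
          invJ (jetAt r σ) = jetAt r (h.invSection σ)) := by
  have := h.lieGroup
  have := h.base.isManifold
  have := h.total.isManifold
  have := h.base.finiteDimensional
  have := h.fiber.finiteDimensional
  have := h.total.t2Space
  have := h.total.secondCountableTopology
  obtain ⟨_, _, hfiber, hgroup, hval, hgc⟩ := JetGroup.exists_lieGroup (E := EM) h.fiber r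
  obtain ⟨_, _, hjet, htarget, hjc⟩ := Jet.exists_chartedSpace h.exists_isAdaptedChart
    (fun ⟨m⟩ => ⟨one m⟩) r
  refine ⟨inferInstance, inferInstance, ?_, JetGroup EM F G r, inferInstance, inferInstance,
    inferInstance, h.jetMul, h.jetOne, h.jetInv, h.jetBundle hjet hfiber hgroup ?_,
    fun _ => h.jetMul_jetAt, fun _ => rfl, fun _ => h.jetInv_jetAt⟩
  · intro φ ψ hψ
    obtain ⟨E, hE, hEs, hEc⟩ := hjc φ ψ hψ
    refine ⟨E, hE, fun m σ => ?_, fun m σ hσ => ?_⟩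
    · rw [hEs, Set.mem_preimage, Jet.target_jetAt]
    · rw [hEc, hψ.coord_jetAt hσ]
      exact ⟨rfl, fun k => JetFiberModel.coeff_of (hψ.contDiffAt_inChart hσ) k⟩
  · intro m e he φ hφ hm
    -- A trivialization needs a total inverse function, hence at least one jet; the unit section
    -- provides it.
    have : Nonempty (Jet EM EP r π) := ⟨h.jetOne m⟩
    exact he.exists_trivialization hφ hval htarget hgc hjc h.contMDiff_proj.continuous
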